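/- Conventions. All logarithms are natural and $0\ln 0=0$. A POVM on $\mathbb C^d$ is given by a $\sigma$-finite reference measure $\mu$ on a measurable outcome space $\Omega$ and a measurable, integrable density $x\mapsto M_x$ of positive semidefinite $d\times d$ matrices with $\int M_x\,\mathrm d\mu(x)=I$ (every POVM on $\mathbb C^d$ has this form; finite POVMs are the case of counting measure on a finite set). A state $\rho$ gives the outcome distribution $\operatorname{tr}(\rho\vec M)$, with density $x\mapsto\operatorname{tr}(\rho M_x)$. For POVMs $\vec M^{(1)},\dots,\vec M^{(n)}$ on $\mathbb C^d$, $\bigotimes_a \vec M^{(a)}$ denotes the product POVM on $(\mathbb C^d)^{\otimes n}$, with reference measure $\prod_a\mu_a$ and density $\bigotimes_a M^{(a)}_{x_a}$. The (classical) Holevo information of a random outcome distribution with density $p_\theta$, where $\theta$ is random, is the entropy of the average minus the average entropy, $$\chi=\int\Big(-\mathbb E_\theta[p_\theta(x)]\ln\mathbb E_\theta[p_\theta(x)]+\mathbb E_\theta[p_\theta(x)\ln p_\theta(x)]\Big)\,\mathrm d\mu(x).$$ Lemma. Let $n\ge 0$, and let $\vec M^{(a)}$, $a=1,\dots,n$,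 be POVMs on $\mathbb C^d$ (on possibly different outcome spaces). (1) Let $d\ge 2$ be even, $r=d/2$, $0\le t\le 1$, $Q=\mathrm{diag}(1,\dots,1,0,\dots,0)$ of rank $r$, and for a $d\times d$ unitary $U$ let $$\tau_{t,U}=\frac{1+t}{2r}UQU^\dagger+\frac{1-t}{2(d-r)}\,(I-UQU^\dagger).$$ For every probability distribution of unitaries $U_j\in\mathbb U(d)$ there is $W\in\mathbb U(d)$ such that the Holevo information of the ensemble $\big\{\operatorname{tr}\big((\tau_{t,WU_j})^{\otimes n}\bigotimes_{a=1}^n\vec M^{(a)}\big)\big\}$ is at most $nt^2/d$. (2) Let $d\ge 3$, $1\le r\le d-1$, $0<t<1/3$, and for $U\in\mathbb U(d-1)$ let $$\omega_{t,U}=(1\oplus U)\,\mathrm{diag}\big(1-t,\underbrace{t/r,\dots,t/r}_{r},\underbrace{0,\dots,0}_{d-r-1}\big)\,(1\oplus U)^\dagger .$$ For every probability distribution of unitaries $U_j\in\mathbb U(d-1)$ there is $W\in\mathbb U(d)$ such that the Holevo information of the ensemble $\big\{\operatorname{tr}\big((W\omega_{t,U_j}W^\dagger)^{\otimes n}\bigotimes_{a=1}^n\vec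 M^{(a)}\big)\big\}$ is at most $4\,\dfrac{nt^2}{r}\,\ln\dfrac 2t$. -/

import Mathlib

open MeasureTheory Matrix
open scoped ENNReal ComplexOrder MatrixOrder

noncomputable section

/-- A POVM `M_x dμ(x)` on the Hilbert space with orthonormal basis `ι` and outcome space `Ω`:
a `σ`-finite reference measure `dμ` and a density `x ↦ M_x` of positive semidefinite matrices
with `∫ M_x dμ(x) = 1`. Since the space is finite dimensional, this is no restriction: every
operator valued POVM `E` has such a density with respect to its trace measure `μ = tr E`.
A POVM with finitely or countably many elements `M_i` is the case of the counting measure. -/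
structure POVM (Ω : Type*) [MeasurableSpace Ω] (ι : Type*) [Fintype ι] [DecidableEq ι] where
  ref : Measure Ω
  sigmaFinite_ref : SigmaFinite ref
  density : Ω → Matrix ι ι ℂ
  measurable_density : ∀ i j, Measurable fun x => density x i j
  posSemidef_density : ∀ x, (density x).PosSemidef
  integrable_density : ∀ i j, Integrable (fun x => density x i j) ref
  integral_density : ∀ i j, ∫ x, density x i j ∂ref = (1 : Matrix ι ι ℂ) i j

attribute [instance] POVM.sigmaFinite_ref

/-- The tensor product `⨂ₐ Aₐ` of `n` matrices of size `d`, as a matrix on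
`(ℂ^d)^{⊗n}`, whose standard basis is indexed by `Fin n → Fin d`. -/
def tensorMatrix {n d : ℕ} (A : Fin n → Matrix (Fin d) (Fin d) ℂ) :
    Matrix (Fin n → Fin d) (Fin n → Fin d) ℂ :=
  Matrix.of fun i j => ∏ a, A a (i a) (j a)

/-- The tensor power `ρ^{⊗n}`. -/
def tensorPow {d : ℕ} (n : ℕ) (ρ : Matrix (Fin d) (Fin d) ℂ) :
    Matrix (Fin n → Fin d) (Fin n → Fin d) ℂ :=
  tensorMatrix fun _ => ρ

theorem tensorMatrix_posSemidef {n d : ℕ} (A : Fin n → Matrix (Fin d) (Fin d) ℂ)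
    (hA : ∀ a, (A a).PosSemidef) : (tensorMatrix A).PosSemidef := by
  have h : ∀ a, ∃ B : Matrix (Fin d) (Fin d) ℂ, A a = Bᴴ * B := by
    intro a
    obtain ⟨B, hB⟩ := CStarAlgebra.nonneg_iff_eq_star_mul_self.mp (hA a).nonneg
    exact ⟨B, hB⟩
  choose B hB using h
  have key : tensorMatrix A = (tensorMatrix B)ᴴ * tensorMatrix B := by
    ext i j
    simp only [tensorMatrix, Matrix.of_apply, hB, Matrix.mul_apply, Matrix.conjTranspose_apply,
      Finset.prod_univ_sum, Fintype.piFinset_univ, star_prod, ← Finset.prod_mul_distrib]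
  rw [key]
  exact Matrix.posSemidef_conjTranspose_mul_self _

/-- The product POVM `⨂ₐ M⁽ᵃ⁾` on `(ℂ^d)^{⊗n}`, with outcomes `(x₁, …, xₙ)`. -/
def POVM.tensor {n d : ℕ} {Ω : Fin n → Type*} [∀ a, MeasurableSpace (Ω a)]
    (M : ∀ a, POVM (Ω a) (Fin d)) : POVM (∀ a, Ω a) (Fin n → Fin d) where
  ref := Measure.pi fun a => (M a).ref
  sigmaFinite_ref := inferInstance
  density x := tensorMatrix fun a => (M a).density (x a)
  measurable_density i j := by
    simp only [tensorMatrix, Matrix.of_apply]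
    exact Finset.measurable_prod _ fun a _ =>
      ((M a).measurable_density (i a) (j a)).comp (measurable_pi_apply a)
  posSemidef_density x := tensorMatrix_posSemidef _ fun a => (M a).posSemidef_density (x a)
  integrable_density i j := by
    simp only [tensorMatrix, Matrix.of_apply]
    exact Integrable.fintype_prod_dep fun a => (M a).integrable_density (i a) (j a)
  integral_density i j := by
    simp only [tensorMatrix, Matrix.of_apply]
    rw [integral_fintype_prod_eq_prod (fun a y => (M a).density y (i a) (j a))]
    simp only [(M _).integral_density, Matrix.one_apply]
    by_cases h : i = j
    · simp [h]
    · obtain ⟨a, ha⟩ := Function.ne_iff.mp h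
      rw [if_neg h]
      exact Finset.prod_eq_zero (Finset.mem_univ a) (if_neg ha)

/-- The outcome distribution `tr (ρ M)`: its density `x ↦ tr (ρ M_x)` with respect to the
reference measure of the POVM. (The trace is a non-negative real for every state `ρ`.) -/
def POVM.outcome {Ω ι : Type*} [MeasurableSpace Ω] [Fintype ι] [DecidableEq ι]
    (M : POVM Ω ι) (ρ : Matrix ι ι ℂ) (x : Ω) : ℝ :=
  (ρ * M.density x).trace.re

/-- The classical Holevo information of the ensemble of outcome distributions
`p_θ = tr (ρ_θ M)`, with `θ` distributed according to `π`: the entropy of the average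
distribution minus the average entropy,
`∫ₓ ( -𝔼[p_θ(x)] ln 𝔼[p_θ(x)] + 𝔼[p_θ(x) ln p_θ(x)] ) dμ(x)`,
with natural logarithms and `0 ln 0 = 0`. The difference is taken inside the integral, so that
it makes sense when the two entropies are infinite; the integrand is non-negative by concavity
of `-p ln p`. -/
def holevoInformation {Θ Ω ι : Type*} [MeasurableSpace Θ] [MeasurableSpace Ω] [Fintype ι]
    [DecidableEq ι] (π : Measure Θ) (ρ : Θ → Matrix ι ι ℂ) (M : POVM Ω ι) : ℝ≥0∞ :=
  ∫⁻ x, ENNReal.ofReal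
    (Real.negMulLog (∫ θ, M.outcome (ρ θ) x ∂π) - ∫ θ, Real.negMulLog (M.outcome (ρ θ) x) ∂π)
    ∂M.ref

/-- The projector `Q = diag(1, …, 1, 0, …, 0)` of rank `r` (for `r ≤ d`). -/
def projQ (d r : ℕ) : Matrix (Fin d) (Fin d) ℂ :=
  Matrix.diagonal fun i => if (i : ℕ) < r then 1 else 0

/-- `τ_{t,U} = (1+t)/(2r) U Q U† + (1-t)/(2(d-r)) (1 - U Q U†)`. -/
def tauState (d r : ℕ) (t : ℝ) (U : Matrix (Fin d) (Fin d) ℂ) : Matrix (Fin d) (Fin d) ℂ :=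
  (((1 + t) / (2 * r) : ℝ) : ℂ) • (U * projQ d r * Uᴴ) +
    (((1 - t) / (2 * ((d : ℝ) - r)) : ℝ) : ℂ) • (1 - U * projQ d r * Uᴴ)

/-- The embedding `U ↦ 1 ⊕ U` of `k × k` matrices into `(k+1) × (k+1)` matrices. -/
def embedMatrix {k : ℕ} (U : Matrix (Fin k) (Fin k) ℂ) : Matrix (Fin (k + 1)) (Fin (k + 1)) ℂ :=
  Matrix.of (Fin.cons (Fin.cons 1 fun _ => 0) fun i => Fin.cons 0 (U i))

/-- `ω_{t,I} = (1-t) ⊕ (t/r) I_r ⊕ 0_{d-r-1}` in dimension `d = k+1`. -/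
def omegaBase (k r : ℕ) (t : ℝ) : Matrix (Fin (k + 1)) (Fin (k + 1)) ℂ :=
  Matrix.diagonal fun i =>
    if (i : ℕ) = 0 then ((1 - t : ℝ) : ℂ) else if (i : ℕ) ≤ r then ((t / r : ℝ) : ℂ) else 0

/-- `ω_{t,U} = (1 ⊕ U) ω_{t,I} (1 ⊕ U)†` in dimension `d = k+1`, for `U` of size `k`. -/
def omegaState (k r : ℕ) (t : ℝ) (U : Matrix (Fin k) (Fin k) ℂ) :
    Matrix (Fin (k + 1)) (Fin (k + 1)) ℂ :=
  embedMatrix U * omegaBase k r t * (embedMatrix U)ᴴ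

end

/-!
Both ensembles have the form `W V_θ diag(a) V_θ† W†`, where the unitaries `V_θ` leave a reference
state `σ = diag(b)` invariant: `V_θ = U_θ` with `σ` maximally mixed for `τ`, and `V_θ = 1 ⊕ U_θ`
with `σ` the average of `ω_{t,U}` over all `U` for `ω`.

The Holevo information is the mean relative entropy to the average distribution, hence at most the
mean relative entropy to the distribution `q` of any other state. Taking `q` to come from
`(W σ W†)^{⊗n}`, everything is a product, so that relative entropy is additive over the copies, and
each term is at most the χ²-divergence (`DominatedSpectra.holevoInformation_le`). The χ²-divergence
is then averaged over a Haar random `W`, which absorbs `V_θ` by right invariance; some `W` is as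
good as the average (`DominatedSpectra.exists_holevoInformation_le`).

Since `(p, q) ↦ (p - q)² / q` is convex and homogeneous, POVM elements may be taken to be of rank
one, and the claim becomes a statement about a uniformly random unit vector `w` in `ℂ^d`: a bound
on the mean of `(∑ (aᵢ - bᵢ) |wᵢ|²)² / ∑ bᵢ |wᵢ|²`. The numerator is a second moment of a traceless
form, determined by invariance under `SU(2)` acting on pairs of coordinates
(`IsSphereLaw.integral_sq_diag_form`); this proves the bound for `τ`. For `ω` the denominator
depends only on `s = |w₀|²`, and the mean of `(1 - s) / (c + a s)` has to be bounded by a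
logarithm. No formula for the law of `s` is needed: differentiating along a rotation gives the
integration by parts formula `E[(1 - s) (s G(s))'] = k E[s G(s)]` (`IsSphereLaw.integral_stein`),
which is applied to a suitable `G` (`IsSphereLaw.integral_inv_affine_le`).
-/

/-! ### Unitarily invariant probability measures on the complex sphere -/

/-- `ν` is a probability measure on `ℂ^d` that is carried by the unit sphere and invariant under
all unitaries. (Such a measure is unique; only its invariance is used.) -/
structure IsSphereLaw {d : ℕ} (ν : Measure (Fin d → ℂ)) : Prop where
  prob : IsProbabilityMeasure ν
  map_mulVec : ∀ V ∈ Matrix.unitaryGroup (Fin d) ℂ, ν.map (fun w => V *ᵥ w) = ν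
  ae_sphere : ∀ᵐ w ∂ν, ∑ i, ‖w i‖ ^ 2 = 1

/-- The action of the element `!![a, b; -b̄, ā]` of `SU(2)` on the coordinates `i`, `j`. -/
def pairMap {d : ℕ} (i j : Fin d) (a b : ℂ) (w : Fin d → ℂ) : Fin d → ℂ := fun p =>
  if p = i then a * w i + b * w j
  else if p = j then -star b * w i + star a * w j else w p

/-- The matrix of `pairMap`. -/
def pairMatrix {d : ℕ} (i j : Fin d) (a b : ℂ) : Matrix (Fin d) (Fin d) ℂ :=
  Matrix.of fun p q =>
    if p = i then (if q = i then a else 0) + (if q = j then b else 0)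
    else if p = j then (if q = i then -star b else 0) + (if q = j then star a else 0)
    else if q = p then 1 else 0

theorem pairMatrix_mulVec {d : ℕ} (i j : Fin d) (a b : ℂ) (w : Fin d → ℂ) :
    pairMatrix i j a b *ᵥ w = pairMap i j a b w := by
  funext p
  simp only [Matrix.mulVec, dotProduct, pairMatrix, pairMap, Matrix.of_apply]
  split_ifs <;> simp [add_mul, Finset.sum_add_distrib, ite_mul]

theorem star_pairMatrix {d : ℕ} {i j : Fin d} (hij : i ≠ j) (a b : ℂ) :
    star (pairMatrix i j a b) = pairMatrix i j (star a) (-b) := by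
  ext p q
  simp only [Matrix.star_apply, pairMatrix, Matrix.of_apply]
  by_cases hpi : p = i <;> by_cases hpj : p = j <;> by_cases hqi : q = i <;>
    by_cases hqj : q = j <;> by_cases hpq : p = q <;>
    simp_all [eq_comm]

theorem pairMatrix_mem_unitaryGroup {d : ℕ} {i j : Fin d} (hij : i ≠ j) {a b : ℂ}
    (hab : star a * a + star b * b = 1) : pairMatrix i j a b ∈ Matrix.unitaryGroup (Fin d) ℂ := by
  rw [Matrix.mem_unitaryGroup_iff', star_pairMatrix hij]
  refine Matrix.ext_of_mulVec_single fun k => ?_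
  rw [← Matrix.mulVec_mulVec, pairMatrix_mulVec, pairMatrix_mulVec, Matrix.one_mulVec]
  generalize (Pi.single k 1 : Fin d → ℂ) = w
  funext p
  simp only [pairMap]
  have hji : j ≠ i := hij.symm
  by_cases hpi : p = i
  · subst hpi
    simp only [if_true, if_neg hji]
    linear_combination w p * hab
  · by_cases hpj : p = j
    · subst hpj
      simp only [if_true, if_neg hji, star_neg, star_star]
      linear_combination w p * hab
    · simp [hpi, hpj]

theorem sum_norm_sq_eq_dotProduct {d : ℕ} (u : Fin d → ℂ) :
    ((∑ p, ‖u p‖ ^ 2 : ℝ) : ℂ) = star u ⬝ᵥ u := by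
  simp only [dotProduct, Pi.star_apply, Complex.ofReal_sum]
  refine Finset.sum_congr rfl fun p _ => ?_
  rw [Complex.ofReal_pow]
  exact (Complex.conj_mul' (u p)).symm

theorem sum_norm_sq_unitary_mulVec {d : ℕ} {V : Matrix (Fin d) (Fin d) ℂ}
    (hV : V ∈ Matrix.unitaryGroup (Fin d) ℂ) (w : Fin d → ℂ) :
    ∑ p, ‖(V *ᵥ w) p‖ ^ 2 = ∑ p, ‖w p‖ ^ 2 := by
  have h2 : ((∑ p, ‖(V *ᵥ w) p‖ ^ 2 : ℝ) : ℂ) = ((∑ p, ‖w p‖ ^ 2 : ℝ) : ℂ) := by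
    rw [sum_norm_sq_eq_dotProduct, sum_norm_sq_eq_dotProduct, Matrix.star_mulVec,
      Matrix.dotProduct_mulVec, Matrix.vecMul_vecMul, ← Matrix.star_eq_conjTranspose,
      Matrix.mem_unitaryGroup_iff'.mp hV, Matrix.vecMul_one]
  exact_mod_cast h2

/-- The phase `e^{iπ/4}`, in the form in which it acts through `pairMap i j z 0`. -/
theorem exists_eighth_root : ∃ z : ℂ, z ^ 2 = Complex.I ∧ (star z) ^ 2 = -Complex.I ∧
    star z * z + star (0 : ℂ) * 0 = 1 := by
  set c : ℂ := ((Real.sqrt 2 / 2 : ℝ) : ℂ) with hc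
  have hc2 : c ^ 2 = 1 / 2 := by
    rw [hc, ← Complex.ofReal_pow, div_pow, Real.sq_sqrt (by norm_num)]; norm_num
  have hcs : star c = c := Complex.conj_ofReal _
  have hzs : star (c * (1 + Complex.I)) = c * (1 - Complex.I) := by
    rw [star_mul', hcs]; simp [sub_eq_add_neg]
  refine ⟨c * (1 + Complex.I), ?_, ?_, ?_⟩
  · rw [mul_pow, hc2]; linear_combination (1 / 2) * Complex.I_sq
  · rw [hzs, mul_pow, hc2]; linear_combination (1 / 2) * Complex.I_sq
  · rw [hzs]; simp only [mul_zero, add_zero]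
    linear_combination (1 - Complex.I ^ 2) * hc2 - (1 / 2) * Complex.I_sq

namespace IsSphereLaw

variable {d : ℕ} {ν : Measure (Fin d → ℂ)}

theorem integral_pairMap (hν : IsSphereLaw ν) {i j : Fin d} (hij : i ≠ j) {a b : ℂ}
    (hab : star a * a + star b * b = 1) (f : (Fin d → ℂ) → ℝ) :
    ∫ w, f (pairMap i j a b w) ∂ν = ∫ w, f w ∂ν := by
  have hV := pairMatrix_mem_unitaryGroup hij hab
  have hc : Continuous fun w : Fin d → ℂ => pairMatrix i j a b *ᵥ w := by fun_prop
  have hinj : Function.Injective fun w : Fin d → ℂ => pairMatrix i j a b *ᵥ w := by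
    intro w w' h
    have h2 := congrArg (fun u => star (pairMatrix i j a b) *ᵥ u) h
    simpa [Matrix.mulVec_mulVec, Matrix.mem_unitaryGroup_iff'.mp hV] using h2
  conv_rhs => rw [← hν.map_mulVec _ hV]
  rw [(hc.measurableEmbedding hinj).integral_map]
  simp only [pairMatrix_mulVec]

theorem isCompact_sphere : IsCompact {w : Fin d → ℂ | ∑ i, ‖w i‖ ^ 2 = 1} := by
  refine Metric.isCompact_of_isClosed_isBounded (isClosed_eq (by fun_prop) continuous_const) ?_
  refine (Metric.isBounded_closedBall (x := (0 : Fin d → ℂ)) (r := 1)).subset fun w hw => ?_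
  rw [mem_closedBall_zero_iff, pi_norm_le_iff_of_nonneg zero_le_one]
  intro i
  have h : ‖w i‖ ^ 2 ≤ 1 := by
    rw [← (show ∑ i, ‖w i‖ ^ 2 = 1 from hw)]
    exact Finset.single_le_sum (f := fun i => ‖w i‖ ^ 2) (fun j _ => sq_nonneg _)
      (Finset.mem_univ i)
  nlinarith [norm_nonneg (w i)]

theorem integrable_of_continuousOn (hν : IsSphereLaw ν) {f : (Fin d → ℂ) → ℝ}
    (hf : ContinuousOn f {w | ∑ i, ‖w i‖ ^ 2 = 1}) : Integrable f ν := by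
  have := hν.prob
  have h := hf.integrableOn_compact (μ := ν) isCompact_sphere
  have hS : ∀ᵐ w ∂ν, w ∈ {w : Fin d → ℂ | ∑ i, ‖w i‖ ^ 2 = 1} := hν.ae_sphere
  rwa [IntegrableOn, Measure.restrict_eq_self_of_ae_mem hS] at h

/-- For a weight `g` that does not see `SU(2)` rotations of the coordinates `i`, `j`, the mixed
fourth moment is half of the pure one. The rotation by `π/4` turns `‖w i‖² ‖w j‖²` into
`‖w j ² - w i ²‖² / 4`, whose cross term averages to zero by a change of phase. -/
theorem integral_mixed_moment (hν : IsSphereLaw ν) {i j : Fin d} (hij : i ≠ j)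
    {g : (Fin d → ℂ) → ℝ} (hg : ContinuousOn g {w | ∑ i, ‖w i‖ ^ 2 = 1})
    (hinv : ∀ a b w, star a * a + star b * b = 1 → g (pairMap i j a b w) = g w) :
    ∫ w, g w * ‖w j‖ ^ 4 ∂ν = ∫ w, g w * ‖w i‖ ^ 4 ∂ν ∧
    ∫ w, g w * (‖w i‖ ^ 2 * ‖w j‖ ^ 2) ∂ν = (∫ w, g w * ‖w i‖ ^ 4 ∂ν) / 2 := by
  have hji : j ≠ i := hij.symm
  have int4 : ∀ l, Integrable (fun w : Fin d → ℂ => g w * ‖w l‖ ^ 4) ν := fun l =>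
    hν.integrable_of_continuousOn (hg.mul (by fun_prop))
  have intc : Integrable (fun w : Fin d → ℂ => g w * (w i ^ 2 * star (w j ^ 2)).re) ν :=
    hν.integrable_of_continuousOn (hg.mul (by
      refine Continuous.continuousOn ?_
      exact Complex.continuous_re.comp (by fun_prop)))
  have hswap : ∫ w, g w * ‖w j‖ ^ 4 ∂ν = ∫ w, g w * ‖w i‖ ^ 4 ∂ν := by
    have h01 : star (0 : ℂ) * 0 + star (1 : ℂ) * 1 = 1 := by simp
    rw [← hν.integral_pairMap hij h01 (fun w => g w * ‖w i‖ ^ 4)]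
    refine integral_congr_ae (Filter.Eventually.of_forall fun w => ?_)
    simp only [hinv _ _ w h01]
    simp [pairMap]
  refine ⟨hswap, ?_⟩
  -- the phase `e^{iπ/4}` changes the sign of `w i ² * conj (w j ²)`
  have hcross : ∫ w, g w * (w i ^ 2 * star (w j ^ 2)).re ∂ν = 0 := by
    obtain ⟨z, hz2, hzs2, hab⟩ := exists_eighth_root
    have h := hν.integral_pairMap hij hab (fun w => g w * (w i ^ 2 * star (w j ^ 2)).re)
    have h2 : ∀ w : Fin d → ℂ, g (pairMap i j z 0 w) * ((pairMap i j z 0 w) i ^ 2 *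
        star ((pairMap i j z 0 w) j ^ 2)).re = -(g w * (w i ^ 2 * star (w j ^ 2)).re) := by
      intro w
      rw [hinv _ _ w hab]
      have : (pairMap i j z 0 w) i ^ 2 * star ((pairMap i j z 0 w) j ^ 2)
          = -(w i ^ 2 * star (w j ^ 2)) := by
        simp only [pairMap, if_true, if_neg hji, zero_mul, add_zero, star_zero, neg_zero, zero_add]
        rw [mul_pow, mul_pow, hz2, hzs2, star_mul', star_neg]
        have : star Complex.I = -Complex.I := Complex.conj_I
        rw [this]
        linear_combination (w i ^ 2 * star (w j ^ 2)) * Complex.I_sq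
      rw [this, Complex.neg_re]; ring
    simp only [h2, integral_neg] at h
    linarith
  have hhad : ∫ w, g w * (‖w i‖ ^ 2 * ‖w j‖ ^ 2) ∂ν
      = ∫ w, ((g w * ‖w i‖ ^ 4 + g w * ‖w j‖ ^ 4) / 4
        - (g w * (w i ^ 2 * star (w j ^ 2)).re) / 2) ∂ν := by
    set c : ℂ := ((Real.sqrt 2 / 2 : ℝ) : ℂ) with hc
    have hc2 : c ^ 2 = 1 / 2 := by
      rw [hc, ← Complex.ofReal_pow, div_pow, Real.sq_sqrt (by norm_num)]; norm_num
    have hcs : star c = c := Complex.conj_ofReal _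
    have hab : star c * c + star c * c = 1 := by rw [hcs]; linear_combination 2 * hc2
    rw [← hν.integral_pairMap hij hab]
    refine integral_congr_ae (Filter.Eventually.of_forall fun w => ?_)
    simp only [hinv _ _ w hab, pairMap, if_true, if_neg hji, hcs]
    have e1 : ‖c * w i + c * w j‖ ^ 2 * ‖-c * w i + c * w j‖ ^ 2 = ‖w j ^ 2 - w i ^ 2‖ ^ 2 / 4 := by
      rw [← mul_pow, ← norm_mul]
      have : (c * w i + c * w j) * (-c * w i + c * w j) = (1 / 2) * (w j ^ 2 - w i ^ 2) := by
        linear_combination (w j ^ 2 - w i ^ 2) * hc2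
      rw [this, norm_mul, mul_pow]; norm_num; ring
    have e2 : ‖w j ^ 2 - w i ^ 2‖ ^ 2 = ‖w i‖ ^ 4 + ‖w j‖ ^ 4
        - 2 * (w i ^ 2 * star (w j ^ 2)).re := by
      have h4 : ∀ z : ℂ, ‖z‖ ^ 4 = Complex.normSq (z ^ 2) := fun z => by
        rw [Complex.normSq_eq_norm_sq, norm_pow]; ring
      rw [h4, h4, ← Complex.normSq_eq_norm_sq]
      rw [← neg_sub, Complex.normSq_neg, Complex.normSq_sub]
      rfl
    rw [e1, e2]; ring
  have hsum : Integrable (fun w : Fin d → ℂ => (g w * ‖w i‖ ^ 4 + g w * ‖w j‖ ^ 4) / 4) ν :=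
    ((int4 i).add (int4 j)).div_const 4
  rw [hhad, integral_sub hsum (intc.div_const 2),
    integral_div, integral_div, integral_add (int4 i) (int4 j), hcross, hswap]
  ring

/-- The second moment of a trace-zero diagonal form under a unitarily invariant law, with a weight
`g` depending only on what `SU(2)` rotations within the coordinates `J` leave fixed. -/
theorem integral_sq_diag_form (hν : IsSphereLaw ν) {J : Finset (Fin d)} (hJ : J.Nonempty)
    {g : (Fin d → ℂ) → ℝ} (hg : ContinuousOn g {w | ∑ i, ‖w i‖ ^ 2 = 1})
    (hinv : ∀ i ∈ J, ∀ j ∈ J, i ≠ j → ∀ a b w, star a * a + star b * b = 1 →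
      g (pairMap i j a b w) = g w)
    (c : Fin d → ℝ) (hc : ∑ i ∈ J, c i = 0) :
    ∫ w, g w * (∑ i ∈ J, c i * ‖w i‖ ^ 2) ^ 2 ∂ν
      = (∑ i ∈ J, c i ^ 2) / (J.card * (J.card + 1)) *
        ∫ w, g w * (∑ i ∈ J, ‖w i‖ ^ 2) ^ 2 ∂ν := by
  obtain ⟨o, ho⟩ := hJ
  set α := ∫ w, g w * ‖w o‖ ^ 4 ∂ν with hα
  have hpure : ∀ i ∈ J, ∫ w, g w * ‖w i‖ ^ 4 ∂ν = α := by
    intro i hi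
    by_cases h : o = i
    · rw [← h]
    · exact (hν.integral_mixed_moment h hg (hinv o ho i hi h)).1
  have hm : ∀ i ∈ J, ∀ j ∈ J, ∫ w, g w * (‖w i‖ ^ 2 * ‖w j‖ ^ 2) ∂ν
      = α / 2 + if i = j then α / 2 else 0 := by
    intro i hi j hj
    split_ifs with h
    · subst h
      rw [add_halves, ← hpure i hi]
      congr 1; funext w; ring
    · rw [(hν.integral_mixed_moment h hg (hinv i hi j hj h)).2, hpure i hi, add_zero]
  have key : ∀ e : Fin d → ℝ, ∫ w, g w * (∑ i ∈ J, e i * ‖w i‖ ^ 2) ^ 2 ∂ν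
      = α / 2 * ((∑ i ∈ J, e i) ^ 2 + ∑ i ∈ J, e i ^ 2) := by
    intro e
    have h1 : ∀ w : Fin d → ℂ, g w * (∑ i ∈ J, e i * ‖w i‖ ^ 2) ^ 2
        = ∑ i ∈ J, ∑ j ∈ J, (e i * e j) * (g w * (‖w i‖ ^ 2 * ‖w j‖ ^ 2)) := by
      intro w
      rw [sq, Finset.sum_mul_sum, Finset.mul_sum]
      refine Finset.sum_congr rfl fun i _ => ?_
      rw [Finset.mul_sum]
      exact Finset.sum_congr rfl fun j _ => by ring
    have hint : ∀ i j, Integrable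
        (fun w : Fin d → ℂ => (e i * e j) * (g w * (‖w i‖ ^ 2 * ‖w j‖ ^ 2))) ν := fun i j =>
      (hν.integrable_of_continuousOn (hg.mul (by fun_prop))).const_mul _
    simp only [h1]
    rw [integral_finsetSum _ fun i _ => integrable_finsetSum _ fun j _ => hint i j]
    have h2 : ∀ i ∈ J, ∫ w, ∑ j ∈ J, (e i * e j) * (g w * (‖w i‖ ^ 2 * ‖w j‖ ^ 2)) ∂ν
        = α / 2 * (e i * ∑ j ∈ J, e j) + α / 2 * e i ^ 2 := by
      intro i hi
      rw [integral_finsetSum _ fun j _ => hint i j]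
      have : ∀ j ∈ J, ∫ w, (e i * e j) * (g w * (‖w i‖ ^ 2 * ‖w j‖ ^ 2)) ∂ν
          = α / 2 * (e i * e j) + if i = j then α / 2 * e i ^ 2 else 0 := by
        intro j hj
        rw [integral_const_mul, hm i hi j hj]
        split_ifs with h
        · subst h; ring
        · ring
      rw [Finset.sum_congr rfl this, Finset.sum_add_distrib, Finset.sum_ite_eq, if_pos hi,
        ← Finset.mul_sum, ← Finset.mul_sum]
    rw [Finset.sum_congr rfl h2, Finset.sum_add_distrib, ← Finset.mul_sum, ← Finset.mul_sum,
      ← Finset.sum_mul]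
    ring
  have h1 := key (fun _ => 1)
  simp only [one_mul, one_pow, Finset.sum_const, nsmul_eq_mul, mul_one] at h1
  have hpos : (0 : ℝ) < J.card := by exact_mod_cast Finset.card_pos.mpr ⟨o, ho⟩
  rw [key c, h1, hc]
  field_simp
  ring

theorem integral_norm_sq (hν : IsSphereLaw ν) (i : Fin d) : ∫ w, ‖w i‖ ^ 2 ∂ν = 1 / d := by
  have := hν.prob
  have hsw : ∀ j, ∫ w, ‖w j‖ ^ 2 ∂ν = ∫ w, ‖w i‖ ^ 2 ∂ν := by
    intro j
    by_cases h : i = j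
    · rw [h]
    · have h01 : star (0 : ℂ) * 0 + star (1 : ℂ) * 1 = 1 := by simp
      rw [← hν.integral_pairMap h h01 (fun w => ‖w i‖ ^ 2)]
      simp [pairMap]
  have hs : ∫ w, ∑ j, ‖w j‖ ^ 2 ∂ν = 1 := by
    rw [integral_congr_ae hν.ae_sphere]; simp
  rw [integral_finsetSum _ fun j _ => hν.integrable_of_continuousOn (by fun_prop),
    Finset.sum_congr rfl fun j _ => hsw j] at hs
  simp only [Finset.sum_const, Finset.card_univ, Fintype.card_fin, nsmul_eq_mul] at hs
  have hd : (d : ℝ) ≠ 0 := by rintro h; simp [h] at hs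
  field_simp
  linarith

end IsSphereLaw

/-! ### Integration by parts for the modulus of one coordinate -/

namespace IsSphereLaw

variable {d : ℕ} {ν : Measure (Fin d → ℂ)}

theorem norm_sq_le_one {w : Fin d → ℂ} (hw : ∑ i, ‖w i‖ ^ 2 = 1) (i : Fin d) : ‖w i‖ ^ 2 ≤ 1 := by
  rw [← hw]
  exact Finset.single_le_sum (f := fun i => ‖w i‖ ^ 2) (fun j _ => sq_nonneg _) (Finset.mem_univ i)

theorem norm_sq_mem_Icc {w : Fin d → ℂ} (hw : ∑ i, ‖w i‖ ^ 2 = 1) (i : Fin d) :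
    ‖w i‖ ^ 2 ∈ Set.Icc (0 : ℝ) 1 := ⟨sq_nonneg _, norm_sq_le_one hw i⟩

theorem sum_norm_sq_pairMap {i j : Fin d} (hij : i ≠ j) {a b : ℂ}
    (hab : star a * a + star b * b = 1) (w : Fin d → ℂ) :
    ∑ p, ‖pairMap i j a b w p‖ ^ 2 = ∑ p, ‖w p‖ ^ 2 := by
  rw [← pairMatrix_mulVec]
  exact sum_norm_sq_unitary_mulVec (pairMatrix_mem_unitaryGroup hij hab) w

/-- Differentiating `∫ Re (w̄ᵢ wⱼ) G(‖wᵢ‖²)` along the rotation of the coordinates `i`, `j` gives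
zero, by invariance. -/
theorem integral_rotation_derivative (hν : IsSphereLaw ν) {i j : Fin d} (hij : i ≠ j)
    {G G' : ℝ → ℝ} (hG : ∀ s, 0 ≤ s → HasDerivAt G (G' s) s) (hG' : ContinuousOn G' (Set.Ici 0)) :
    ∫ w, ((‖w j‖ ^ 2 - ‖w i‖ ^ 2) * G (‖w i‖ ^ 2)
      + 2 * (star (w i) * w j).re ^ 2 * G' (‖w i‖ ^ 2)) ∂ν = 0 := by
  have := hν.prob
  have hji : j ≠ i := hij.symm
  have hGc : ContinuousOn G (Set.Ici 0) := fun s hs => (hG s hs).continuousAt.continuousWithinAt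
  obtain ⟨K, hK⟩ := (isCompact_Icc (a := (0 : ℝ)) (b := 1)).exists_bound_of_continuousOn
    (hGc.mono fun s hs => hs.1)
  obtain ⟨K', hK'⟩ := (isCompact_Icc (a := (0 : ℝ)) (b := 1)).exists_bound_of_continuousOn
    (hG'.mono fun s hs => hs.1)
  -- the rotation `R φ`, the function `ψ` and its derivative `X` along the rotation
  set R : ℝ → (Fin d → ℂ) → (Fin d → ℂ) := fun φ =>
    pairMap i j (Real.cos φ : ℂ) (Real.sin φ : ℂ) with hR
  set B : (Fin d → ℂ) → ℝ := fun w => (star (w i) * w j).re with hB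
  set ψ : (Fin d → ℂ) → ℝ := fun w => B w * G (‖w i‖ ^ 2) with hψ
  set X : (Fin d → ℂ) → ℝ := fun w =>
    (‖w j‖ ^ 2 - ‖w i‖ ^ 2) * G (‖w i‖ ^ 2) + 2 * B w ^ 2 * G' (‖w i‖ ^ 2) with hX
  have hBc : Continuous B := Complex.continuous_re.comp (by fun_prop)
  have hcs : ∀ φ : ℝ, star (Real.cos φ : ℂ) * (Real.cos φ : ℂ)
      + star (Real.sin φ : ℂ) * (Real.sin φ : ℂ) = 1 := by
    intro φ
    have h1 : star (Real.cos φ : ℂ) = (Real.cos φ : ℂ) := Complex.conj_ofReal _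
    have h2 : star (Real.sin φ : ℂ) = (Real.sin φ : ℂ) := Complex.conj_ofReal _
    rw [h1, h2]
    exact_mod_cast (by nlinarith [Real.sin_sq_add_cos_sq φ] :
      Real.cos φ * Real.cos φ + Real.sin φ * Real.sin φ = 1)
  have hsph : ∀ φ w, ∑ p, ‖R φ w p‖ ^ 2 = ∑ p, ‖w p‖ ^ 2 := fun φ w =>
    sum_norm_sq_pairMap hij (hcs φ) w
  have hRc : ∀ φ, Continuous (R φ) := by
    intro φ
    have : R φ = fun w => pairMatrix i j (Real.cos φ : ℂ) (Real.sin φ : ℂ) *ᵥ w := by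
      funext w; rw [pairMatrix_mulVec]
    rw [this]; fun_prop
  have hnc : ∀ φ, Continuous fun w => ‖R φ w i‖ ^ 2 := fun φ =>
    (((continuous_apply i).comp (hRc φ)).norm).pow 2
  have hnc' : ∀ φ, Continuous fun w => ‖R φ w j‖ ^ 2 := fun φ =>
    (((continuous_apply j).comp (hRc φ)).norm).pow 2
  have hψc : ∀ φ, Continuous fun w => ψ (R φ w) := fun φ =>
    (hBc.comp (hRc φ)).mul (hGc.comp_continuous (hnc φ) fun w => Set.mem_Ici.mpr (sq_nonneg _))
  have hXc : ∀ φ, Continuous fun w => X (R φ w) := fun φ =>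
    (((hnc' φ).sub (hnc φ)).mul (hGc.comp_continuous (hnc φ) fun w => Set.mem_Ici.mpr (sq_nonneg _))).add
      ((continuous_const.mul ((hBc.comp (hRc φ)).pow 2)).mul
        (hG'.comp_continuous (hnc φ) fun w => Set.mem_Ici.mpr (sq_nonneg _)))
  have hXb : ∀ w : Fin d → ℂ, ∑ i, ‖w i‖ ^ 2 = 1 → ‖X w‖ ≤ K + 2 * K' := by
    intro w hw
    have hi := norm_sq_mem_Icc hw i
    have hj := norm_sq_mem_Icc hw j
    have hBw : |B w| ≤ 1 := by
      refine (Complex.abs_re_le_norm _).trans ?_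
      rw [norm_mul, norm_star]
      nlinarith [hi.2, hj.2, sq_nonneg (‖w i‖ - ‖w j‖)]
    have h1 : |‖w j‖ ^ 2 - ‖w i‖ ^ 2| ≤ 1 := by
      rw [abs_le]; constructor <;> linarith [hi.1, hi.2, hj.1, hj.2]
    have h2 : B w ^ 2 ≤ 1 := by rwa [sq_le_one_iff_abs_le_one]
    have h3 := hK _ hi
    have h4 := hK' _ hi
    rw [Real.norm_eq_abs] at h3 h4 ⊢
    refine (abs_add_le _ _).trans ?_
    rw [abs_mul, abs_mul, abs_mul, abs_two, abs_of_nonneg (sq_nonneg (B w))]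
    have h5 := mul_le_mul h1 h3 (abs_nonneg _) zero_le_one
    have h6 := mul_le_mul h2 h4 (abs_nonneg _) zero_le_one
    linarith
  have hderiv : ∀ w φ, HasDerivAt (fun φ => ψ (R φ w)) (X (R φ w)) φ := by
    intro w φ
    have e1 : ∀ φ, R φ w i = Real.cos φ * w i + Real.sin φ * w j := fun φ => by
      simp [hR, pairMap]
    have e2 : ∀ φ, R φ w j = -Real.sin φ * w i + Real.cos φ * w j := fun φ => by
      have h1 : star (Real.cos φ : ℂ) = (Real.cos φ : ℂ) := Complex.conj_ofReal _
      have h2 : star (Real.sin φ : ℂ) = (Real.sin φ : ℂ) := Complex.conj_ofReal _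
      simp only [hR, pairMap, if_neg hji, if_true, h1, h2]
    have nsq : ∀ z : ℂ, ‖z‖ ^ 2 = z.re ^ 2 + z.im ^ 2 := fun z => by
      rw [← Complex.normSq_eq_norm_sq, Complex.normSq_apply]; ring
    have eA : ∀ φ, ‖R φ w i‖ ^ 2 = Real.cos φ ^ 2 * ‖w i‖ ^ 2 + Real.sin φ ^ 2 * ‖w j‖ ^ 2
        + 2 * (Real.cos φ * Real.sin φ) * B w := fun φ => by
      rw [e1, nsq, nsq, nsq]
      generalize Real.cos φ = x
      generalize Real.sin φ = y
      simp [hB, Complex.mul_re]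
      ring
    have eD : ∀ φ, ‖R φ w j‖ ^ 2 = Real.sin φ ^ 2 * ‖w i‖ ^ 2 + Real.cos φ ^ 2 * ‖w j‖ ^ 2
        - 2 * (Real.cos φ * Real.sin φ) * B w := fun φ => by
      rw [e2, nsq, nsq, nsq]
      generalize Real.cos φ = x
      generalize Real.sin φ = y
      simp [hB, Complex.mul_re]
      ring
    have eB : ∀ φ, B (R φ w) = (Real.cos φ * Real.sin φ) * (‖w j‖ ^ 2 - ‖w i‖ ^ 2)
        + (Real.cos φ ^ 2 - Real.sin φ ^ 2) * B w := fun φ => by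
      simp only [hB]
      rw [e1, e2, nsq, nsq]
      generalize Real.cos φ = x
      generalize Real.sin φ = y
      simp [Complex.mul_re]
      ring
    have dc := Real.hasDerivAt_cos φ
    have ds := Real.hasDerivAt_sin φ
    have dA : HasDerivAt (fun φ => ‖R φ w i‖ ^ 2) (2 * B (R φ w)) φ := by
      simp only [eA, eB]
      refine ((((dc.pow 2).mul_const (‖w i‖ ^ 2)).add ((ds.pow 2).mul_const (‖w j‖ ^ 2))).add
        (((dc.mul ds).const_mul 2).mul_const (B w))).congr_deriv ?_
      norm_num
      ring
    have dB : HasDerivAt (fun φ => B (R φ w)) (‖R φ w j‖ ^ 2 - ‖R φ w i‖ ^ 2) φ := by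
      simp only [eA, eB, eD]
      refine (((dc.mul ds).mul_const (‖w j‖ ^ 2 - ‖w i‖ ^ 2)).add
        (((dc.pow 2).sub (ds.pow 2)).mul_const (B w))).congr_deriv ?_
      norm_num
      ring
    have dG := (hG (‖R φ w i‖ ^ 2) (sq_nonneg _)).comp φ dA
    refine (dB.mul dG).congr_deriv ?_
    simp only [hX, Function.comp]
    ring
  have main := hasDerivAt_integral_of_dominated_loc_of_deriv_le (μ := ν) (𝕜 := ℝ)
    (F := fun φ w => ψ (R φ w)) (F' := fun φ w => X (R φ w)) (x₀ := (0 : ℝ)) (s := Set.univ)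
    (bound := fun _ => K + 2 * K') Filter.univ_mem
    (Filter.Eventually.of_forall fun φ => (hψc φ).aestronglyMeasurable)
    (hν.integrable_of_continuousOn (hψc 0).continuousOn)
    (hXc 0).aestronglyMeasurable
    (by
      filter_upwards [hν.ae_sphere] with w hw φ _
      exact hXb _ ((hsph φ w).trans hw))
    (integrable_const _)
    (Filter.Eventually.of_forall fun w φ _ => hderiv w φ)
  have hconst : (fun φ : ℝ => ∫ w, ψ (R φ w) ∂ν) = fun _ => ∫ w, ψ w ∂ν := by
    funext φ
    exact hν.integral_pairMap hij (hcs φ) ψ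
  have h0 := main.2
  rw [hconst] at h0
  have hz := h0.unique (hasDerivAt_const (0 : ℝ) _)
  have hR0 : ∀ w, R 0 w = w := fun w => by
    funext p
    simp only [hR, pairMap, Real.cos_zero, Real.sin_zero]
    split_ifs with h1 h2
    · simp [h1]
    · simp [h2]
    · rfl
  simpa only [hR0] using hz

/-- Integration by parts for `s = ‖w₀‖²`: under the invariant law on the sphere of `ℂ^(k+1)`,
`E[(1 - s) (s G(s))'] = k E[s G(s)]`. -/
theorem integral_stein {k : ℕ} {ν : Measure (Fin (k + 1) → ℂ)} (hν : IsSphereLaw ν)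
    {G G' : ℝ → ℝ} (hG : ∀ s, 0 ≤ s → HasDerivAt G (G' s) s) (hG' : ContinuousOn G' (Set.Ici 0)) :
    ∫ w, (1 - ‖w 0‖ ^ 2) * (G (‖w 0‖ ^ 2) + ‖w 0‖ ^ 2 * G' (‖w 0‖ ^ 2)) ∂ν
      = k * ∫ w, ‖w 0‖ ^ 2 * G (‖w 0‖ ^ 2) ∂ν := by
  have hGc : ContinuousOn G (Set.Ici 0) := fun s hs => (hG s hs).continuousAt.continuousWithinAt
  have c1 : Continuous fun w : Fin (k + 1) → ℂ => G (‖w 0‖ ^ 2) :=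
    hGc.comp_continuous (by fun_prop) fun w => Set.mem_Ici.mpr (sq_nonneg _)
  have c2 : Continuous fun w : Fin (k + 1) → ℂ => G' (‖w 0‖ ^ 2) :=
    hG'.comp_continuous (by fun_prop) fun w => Set.mem_Ici.mpr (sq_nonneg _)
  have hj : ∀ j : Fin k, ∫ w, ((‖w j.succ‖ ^ 2 - ‖w 0‖ ^ 2) * G (‖w 0‖ ^ 2)
      + ‖w 0‖ ^ 2 * ‖w j.succ‖ ^ 2 * G' (‖w 0‖ ^ 2)) ∂ν = 0 := by
    intro j
    have h0j : (0 : Fin (k + 1)) ≠ j.succ := (Fin.succ_ne_zero j).symm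
    have hre : Continuous fun w : Fin (k + 1) → ℂ => (star (w 0) * w j.succ).re :=
      Complex.continuous_re.comp (by fun_prop)
    have him : Continuous fun w : Fin (k + 1) → ℂ => (star (w 0) * w j.succ).im :=
      Complex.continuous_im.comp (by fun_prop)
    have i1 : Integrable (fun w : Fin (k + 1) → ℂ =>
        (‖w j.succ‖ ^ 2 - ‖w 0‖ ^ 2) * G (‖w 0‖ ^ 2)) ν :=
      hν.integrable_of_continuousOn
        (Continuous.mul (by fun_prop) c1).continuousOn
    have i2 : Integrable (fun w : Fin (k + 1) → ℂ =>
        (star (w 0) * w j.succ).re ^ 2 * G' (‖w 0‖ ^ 2)) ν :=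
      hν.integrable_of_continuousOn ((hre.pow 2).mul c2).continuousOn
    have i3 : Integrable (fun w : Fin (k + 1) → ℂ =>
        (star (w 0) * w j.succ).im ^ 2 * G' (‖w 0‖ ^ 2)) ν :=
      hν.integrable_of_continuousOn ((him.pow 2).mul c2).continuousOn
    -- a change of phase exchanges the real and the imaginary part of `w̄₀ wⱼ`
    have hphase : ∫ w, (star (w 0) * w j.succ).im ^ 2 * G' (‖w 0‖ ^ 2) ∂ν
        = ∫ w, (star (w 0) * w j.succ).re ^ 2 * G' (‖w 0‖ ^ 2) ∂ν := by
      obtain ⟨z, hz2, hzs2, hab⟩ := exists_eighth_root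
      have hzn : ‖z‖ = 1 := by
        have : ‖z‖ ^ 2 = 1 := by rw [← norm_pow, hz2, Complex.norm_I]
        nlinarith [norm_nonneg z]
      rw [← hν.integral_pairMap h0j hab
        (fun w => (star (w 0) * w j.succ).re ^ 2 * G' (‖w 0‖ ^ 2))]
      refine integral_congr_ae (Filter.Eventually.of_forall fun w => ?_)
      have e1 : pairMap 0 j.succ z 0 w 0 = z * w 0 := by simp [pairMap]
      have e2 : pairMap 0 j.succ z 0 w j.succ = star z * w j.succ := by
        simp [pairMap, Fin.succ_ne_zero]
      have e3 : star (z * w 0) * (star z * w j.succ) = -Complex.I * (star (w 0) * w j.succ) := by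
        rw [← hzs2, star_mul']; ring
      simp only [e1, e2, e3, norm_mul, hzn, one_mul]
      simp only [Complex.mul_re, Complex.neg_re, Complex.neg_im, Complex.I_re, Complex.I_im]
      ring
    have h := hν.integral_rotation_derivative h0j hG hG'
    have e4 : ∀ w : Fin (k + 1) → ℂ, ‖w 0‖ ^ 2 * ‖w j.succ‖ ^ 2
        = (star (w 0) * w j.succ).re ^ 2 + (star (w 0) * w j.succ).im ^ 2 := by
      intro w
      rw [← mul_pow, ← norm_star (w 0), ← norm_mul, ← Complex.normSq_eq_norm_sq,
        Complex.normSq_apply]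
      ring
    simp only [e4, add_mul, mul_assoc] at h ⊢
    rw [integral_add i1 (i2.const_mul 2), integral_const_mul] at h
    have i23 : Integrable (fun w : Fin (k + 1) → ℂ => (star (w 0) * w j.succ).re ^ 2 *
        G' (‖w 0‖ ^ 2) + (star (w 0) * w j.succ).im ^ 2 * G' (‖w 0‖ ^ 2)) ν := i2.add i3
    rw [integral_add i1 i23, integral_add i2 i3, hphase]
    linarith
  have hsum : ∫ w, ∑ j : Fin k, ((‖w j.succ‖ ^ 2 - ‖w 0‖ ^ 2) * G (‖w 0‖ ^ 2)
      + ‖w 0‖ ^ 2 * ‖w j.succ‖ ^ 2 * G' (‖w 0‖ ^ 2)) ∂ν = 0 := by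
    have hi : ∀ j : Fin k, Integrable (fun w : Fin (k + 1) → ℂ =>
        (‖w j.succ‖ ^ 2 - ‖w 0‖ ^ 2) * G (‖w 0‖ ^ 2)
          + ‖w 0‖ ^ 2 * ‖w j.succ‖ ^ 2 * G' (‖w 0‖ ^ 2)) ν := fun j =>
      hν.integrable_of_continuousOn (Continuous.add (Continuous.mul (by fun_prop) c1)
        (Continuous.mul (by fun_prop) c2)).continuousOn
    rw [integral_finsetSum _ fun j _ => hi j]
    exact Finset.sum_eq_zero fun j _ => hj j
  have hi1 : Integrable (fun w : Fin (k + 1) → ℂ =>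
      (1 - ‖w 0‖ ^ 2) * (G (‖w 0‖ ^ 2) + ‖w 0‖ ^ 2 * G' (‖w 0‖ ^ 2))) ν :=
    hν.integrable_of_continuousOn (Continuous.mul (by fun_prop)
      (c1.add (Continuous.mul (by fun_prop) c2))).continuousOn
  have hi2 : Integrable (fun w : Fin (k + 1) → ℂ => (k : ℝ) * (‖w 0‖ ^ 2 * G (‖w 0‖ ^ 2))) ν :=
    hν.integrable_of_continuousOn
      (continuous_const.mul (Continuous.mul (by fun_prop) c1)).continuousOn
  rw [← integral_const_mul, ← sub_eq_zero, ← integral_sub hi1 hi2, ← hsum]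
  refine integral_congr_ae ?_
  filter_upwards [hν.ae_sphere] with w hw
  rw [Fin.sum_univ_succ] at hw
  simp only [Finset.sum_add_distrib, ← Finset.sum_mul, Finset.sum_sub_distrib, ← Finset.mul_sum,
    Finset.sum_const, Finset.card_univ, Fintype.card_fin, nsmul_eq_mul]
  rw [show ∑ j : Fin k, ‖w j.succ‖ ^ 2 = 1 - ‖w 0‖ ^ 2 by linarith]
  ring

/-- The logarithmic bound on the singular integral `E[(1 - s) / (c + a s)]`. It is the integration
by parts formula for `G(s) = (1 + ln (1 + a s / c)) / (c + a s)`, which satisfies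
`(s G)' ≥ 1 / (c + a s)` and `s G ≤ (1 + ln (1 + a s / c)) / a`. -/
theorem integral_inv_affine_le {k : ℕ} {ν : Measure (Fin (k + 1) → ℂ)} (hν : IsSphereLaw ν)
    {a c : ℝ} (ha : 0 < a) (hc : 0 < c) :
    ∫ w, (1 - ‖w 0‖ ^ 2) / (c + a * ‖w 0‖ ^ 2) ∂ν
      ≤ k / a * (1 + Real.log (1 + a / (c * (k + 1)))) := by
  have := hν.prob
  have hpos : ∀ s : ℝ, 0 ≤ s → 0 < c + a * s := fun s hs => by positivity
  have hpos1 : ∀ s : ℝ, 0 ≤ s → 0 < 1 + a / c * s := fun s hs => by positivity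
  have hlog : ∀ s : ℝ, 0 ≤ s → 0 ≤ Real.log (1 + a / c * s) := fun s hs =>
    Real.log_nonneg (by have : 0 ≤ a / c * s := by positivity
                        linarith)
  set G : ℝ → ℝ := fun s => (1 + Real.log (1 + a / c * s)) / (c + a * s) with hGdef
  set G' : ℝ → ℝ := fun s => -(a * Real.log (1 + a / c * s)) / (c + a * s) ^ 2 with hGdef'
  have hG : ∀ s, 0 ≤ s → HasDerivAt G (G' s) s := by
    intro s hs
    have h1 : HasDerivAt (fun s => 1 + a / c * s) (a / c) s := by
      simpa using ((hasDerivAt_id s).const_mul (a / c)).const_add 1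
    have h2 : HasDerivAt (fun s => c + a * s) a s := by
      simpa using ((hasDerivAt_id s).const_mul a).const_add c
    refine (((h1.log (hpos1 s hs).ne').const_add 1).div h2 (hpos s hs).ne').congr_deriv ?_
    have e : 1 + a / c * s = (c + a * s) / c := by field_simp
    simp only [hGdef']
    rw [div_left_inj' (pow_ne_zero 2 (hpos s hs).ne')]
    have : a / c / (1 + a / c * s) * (c + a * s) = a := by
      rw [e]; have := (hpos s hs).ne'; field_simp
    rw [this]; ring
  have hlogc : ContinuousOn (fun s => Real.log (1 + a / c * s)) (Set.Ici 0) :=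
    ContinuousOn.log (by fun_prop) fun s hs => (hpos1 s hs).ne'
  have hG' : ContinuousOn G' (Set.Ici 0) :=
    ((continuousOn_const.mul hlogc).neg).div (by fun_prop)
      fun s hs => pow_ne_zero 2 (hpos s hs).ne'
  have hGc : ContinuousOn G (Set.Ici 0) := fun s hs => (hG s hs).continuousAt.continuousWithinAt
  have cn : Continuous fun w : Fin (k + 1) → ℂ => ‖w 0‖ ^ 2 := by fun_prop
  have c1 := hGc.comp_continuous cn fun w => Set.mem_Ici.mpr (sq_nonneg _)
  have c2 := hG'.comp_continuous cn fun w => Set.mem_Ici.mpr (sq_nonneg _)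
  have step1 : ∫ w, (1 - ‖w 0‖ ^ 2) / (c + a * ‖w 0‖ ^ 2) ∂ν
      ≤ ∫ w, (1 - ‖w 0‖ ^ 2) * (G (‖w 0‖ ^ 2) + ‖w 0‖ ^ 2 * G' (‖w 0‖ ^ 2)) ∂ν := by
    refine integral_mono_ae
      (hν.integrable_of_continuousOn (Continuous.div (by fun_prop) (by fun_prop)
        fun w => (hpos _ (sq_nonneg _)).ne').continuousOn)
      (hν.integrable_of_continuousOn ((continuous_const.sub cn).mul
        (c1.add (cn.mul c2))).continuousOn) ?_
    filter_upwards [hν.ae_sphere] with w hw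
    have hs := norm_sq_mem_Icc hw 0
    generalize ‖w 0‖ ^ 2 = s at hs ⊢
    have h1 := hpos s hs.1
    have h2 := hlog s hs.1
    rw [div_eq_mul_inv]
    refine mul_le_mul_of_nonneg_left ?_ (by linarith [hs.2])
    have : G s + s * G' s = (c + a * s)⁻¹ + c * Real.log (1 + a / c * s) / (c + a * s) ^ 2 := by
      simp only [hGdef, hGdef']
      field_simp
      ring
    rw [this]
    have : 0 ≤ c * Real.log (1 + a / c * s) / (c + a * s) ^ 2 := by positivity
    linarith
  -- the tangent line of the logarithm at the mean value of its argument
  set y : ℝ := 1 + a / (c * (k + 1)) with hy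
  have hy0 : 0 < y := by positivity
  have step2 : ∫ w, ‖w 0‖ ^ 2 * G (‖w 0‖ ^ 2) ∂ν
      ≤ ∫ w, (1 + Real.log y + ((1 + a / c * ‖w 0‖ ^ 2) / y - 1)) / a ∂ν := by
    refine integral_mono_ae (hν.integrable_of_continuousOn (cn.mul c1).continuousOn)
      (hν.integrable_of_continuousOn (by fun_prop)) ?_
    filter_upwards [hν.ae_sphere] with w hw
    have hs := norm_sq_mem_Icc hw 0
    generalize ‖w 0‖ ^ 2 = s at hs ⊢
    have h1 := hpos s hs.1
    have h2 := hlog s hs.1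
    have h3 : Real.log (1 + a / c * s) ≤ Real.log y + ((1 + a / c * s) / y - 1) := by
      have := Real.log_le_sub_one_of_pos (div_pos (hpos1 s hs.1) hy0)
      rw [Real.log_div (hpos1 s hs.1).ne' hy0.ne'] at this
      linarith
    rw [le_div_iff₀ ha]
    have h4 : s * G s * a ≤ 1 + Real.log (1 + a / c * s) := by
      simp only [hGdef]
      rw [mul_div_assoc', div_mul_eq_mul_div, div_le_iff₀ h1]
      nlinarith
    linarith
  have step3 : ∫ w, (1 + Real.log y + ((1 + a / c * ‖w 0‖ ^ 2) / y - 1)) / a ∂ν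
      = (1 + Real.log y) / a := by
    have e : ∀ w : Fin (k + 1) → ℂ, (1 + Real.log y + ((1 + a / c * ‖w 0‖ ^ 2) / y - 1)) / a
        = (Real.log y + 1 / y) / a + (1 / (c * y)) * ‖w 0‖ ^ 2 := by
      intro w; field_simp; ring
    simp only [e]
    rw [integral_add (integrable_const _)
      ((hν.integrable_of_continuousOn (by fun_prop)).const_mul _), integral_const_mul,
      hν.integral_norm_sq, integral_const]
    simp only [probReal_univ, one_smul]
    have : 1 / y + a / (c * y) * (1 / (k + 1)) = 1 := by
      rw [hy]; field_simp
    push_cast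
    rw [show (1 + Real.log y) / a = (Real.log y + (1 / y + a / (c * y) * (1 / (k + 1)))) / a by
      rw [this, add_comm]]
    field_simp
    ring
  calc _ ≤ k * ∫ w, ‖w 0‖ ^ 2 * G (‖w 0‖ ^ 2) ∂ν := by
        rw [← hν.integral_stein hG hG']; exact step1
    _ ≤ k * ((1 + Real.log y) / a) := by
        refine mul_le_mul_of_nonneg_left (step2.trans step3.le) (Nat.cast_nonneg k)
    _ = _ := by ring

end IsSphereLaw

/-! ### Mean χ²-divergence of the two ensembles in a random direction -/

theorem sum_fin_ite_lt {m r : ℕ} (h : r ≤ m) (x y : ℝ) :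
    ∑ i : Fin m, (if (i : ℕ) < r then x else y) = r * x + (m - r) * y := by
  obtain ⟨q, rfl⟩ := Nat.exists_eq_add_of_le h
  rw [Fin.sum_univ_add]
  simp

/-- The spectrum of `τ_{t,U}` in dimension `d`, for `r = d / 2`. -/
noncomputable def tauSpectrum (d : ℕ) (t : ℝ) (i : Fin d) : ℝ :=
  if (i : ℕ) < d / 2 then (1 + t) / d else (1 - t) / d

/-- The spectrum of `ω_{t,U}` in dimension `k + 1`. -/
noncomputable def omegaSpectrum (k r : ℕ) (t : ℝ) (i : Fin (k + 1)) : ℝ :=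
  if (i : ℕ) = 0 then 1 - t else if (i : ℕ) ≤ r then t / r else 0

/-- The spectrum of the average of `ω_{t,U}` over all `U`. -/
noncomputable def omegaMeanSpectrum (k : ℕ) (t : ℝ) (i : Fin (k + 1)) : ℝ :=
  if (i : ℕ) = 0 then 1 - t else t / k

/-- The contribution of a rank one POVM element `|v⟩⟨v|` to the χ²-divergence of the states with
spectra `a` and `b` and a common eigenbasis, in which `v` has the coordinates `w`. -/
noncomputable def diagChiSq {d : ℕ} (a b : Fin d → ℝ) (w : Fin d → ℂ) : ℝ :=
  (∑ i, (a i - b i) * ‖w i‖ ^ 2) ^ 2 / ∑ i, b i * ‖w i‖ ^ 2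

namespace IsSphereLaw

theorem integral_diagChiSq_tau_le {d : ℕ} (hd : 0 < d) (he : Even d) (t : ℝ)
    {ν : Measure (Fin d → ℂ)} (hν : IsSphereLaw ν) :
    ∫ w, diagChiSq (tauSpectrum d t) (fun _ => 1 / d) w ∂ν ≤ t ^ 2 / d ^ 2 := by
  have hd0 : (0 : ℝ) < d := by exact_mod_cast hd
  have hhalf : ((d / 2 : ℕ) : ℝ) = d / 2 := by
    rw [Nat.cast_div he.two_dvd (by norm_num)]; norm_num
  set c : Fin d → ℝ := fun i => if (i : ℕ) < d / 2 then t / d else -(t / d) with hcdef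
  have hc : ∀ i, tauSpectrum d t i - 1 / d = c i := by
    intro i
    simp only [tauSpectrum, hcdef]
    split_ifs <;> ring
  have hc0 : ∑ i ∈ Finset.univ, c i = 0 := by
    simp only [hcdef]
    rw [sum_fin_ite_lt (Nat.div_le_self d 2), hhalf]; ring
  have hc2 : ∑ i ∈ Finset.univ, c i ^ 2 = t ^ 2 / d := by
    have : ∀ i, c i ^ 2 = t ^ 2 / d ^ 2 := fun i => by
      simp only [hcdef]; split_ifs <;> ring
    simp only [this, Finset.sum_const, Finset.card_univ, Fintype.card_fin, nsmul_eq_mul]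
    field_simp
  have : Nonempty (Fin d) := ⟨⟨0, hd⟩⟩
  have h := hν.integral_sq_diag_form (J := Finset.univ) Finset.univ_nonempty
    (g := fun _ => (d : ℝ)) continuousOn_const (fun _ _ _ _ _ _ _ _ _ => rfl) c hc0
  have h1 : ∫ w, diagChiSq (tauSpectrum d t) (fun _ => 1 / d) w ∂ν
      = ∫ w, d * (∑ i, c i * ‖w i‖ ^ 2) ^ 2 ∂ν := by
    refine integral_congr_ae ?_
    filter_upwards [hν.ae_sphere] with w hw
    simp only [diagChiSq, hc, ← Finset.mul_sum, hw]
    field_simp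
  have h2 : ∫ w, (d : ℝ) * (∑ i, ‖w i‖ ^ 2) ^ 2 ∂ν = d := by
    have := hν.prob
    have h3 : ∀ᵐ w ∂ν, (d : ℝ) * (∑ i, ‖w i‖ ^ 2) ^ 2 = d := by
      filter_upwards [hν.ae_sphere] with w hw
      rw [hw]; ring
    rw [integral_congr_ae h3]; simp
  rw [h1, h, h2, hc2, Finset.card_univ, Fintype.card_fin]
  rw [div_div, div_mul_eq_mul_div, div_le_div_iff₀ (by positivity) (by positivity)]
  nlinarith [mul_nonneg (sq_nonneg t) (sq_nonneg (d : ℝ))]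

theorem integral_diagChiSq_omega_le {k r : ℕ} {t : ℝ} (hr : 1 ≤ r) (hrk : r ≤ k)
    (ht : 0 < t) (ht3 : t < 1 / 3) {ν : Measure (Fin (k + 1) → ℂ)} (hν : IsSphereLaw ν) :
    ∫ w, diagChiSq (omegaSpectrum k r t) (omegaMeanSpectrum k t) w ∂ν
      ≤ 4 * t ^ 2 / (r * (k + 1)) * Real.log (2 / t) := by
  have hr0 : (0 : ℝ) < r := by exact_mod_cast hr
  have hk : 1 ≤ k := hr.trans hrk
  have hk0 : (0 : ℝ) < k := by exact_mod_cast hk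
  set c : Fin (k + 1) → ℝ := fun i => omegaSpectrum k r t i - omegaMeanSpectrum k t i with hc
  have hcz : c 0 = 0 := by simp [hc, omegaSpectrum, omegaMeanSpectrum]
  have hcs : ∀ j : Fin k, c j.succ = if (j : ℕ) < r then t / r - t / k else -(t / k) := by
    intro j
    simp only [hc, omegaSpectrum, omegaMeanSpectrum, Fin.val_succ, Nat.succ_ne_zero, if_false,
      Nat.succ_le_iff]
    split_ifs <;> ring
  set J : Finset (Fin (k + 1)) := Finset.univ.map (Fin.succEmb k) with hJ
  have hsumJ : ∀ f : Fin (k + 1) → ℝ, ∑ i ∈ J, f i = ∑ j : Fin k, f j.succ := by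
    intro f; rw [hJ, Finset.sum_map]; rfl
  have hJc : J.card = k := by simp [hJ]
  have h0J : ∀ i ∈ J, i ≠ 0 := by
    intro i hi
    obtain ⟨j, -, rfl⟩ := Finset.mem_map.mp hi
    exact Fin.succ_ne_zero j
  have hc0 : ∑ i ∈ J, c i = 0 := by
    rw [hsumJ]
    simp only [hcs]
    rw [sum_fin_ite_lt hrk]
    field_simp
    ring
  have hc2 : ∑ i ∈ J, c i ^ 2 ≤ t ^ 2 / r := by
    rw [hsumJ]
    have : ∀ j : Fin k, c j.succ ^ 2
        = if (j : ℕ) < r then (t / r - t / k) ^ 2 else (-(t / k)) ^ 2 := fun j => by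
      rw [hcs]; split_ifs <;> rfl
    simp only [this]
    rw [sum_fin_ite_lt hrk]
    have e : r * (t / r - t / k) ^ 2 + (k - r) * (-(t / k)) ^ 2 = t ^ 2 / r - t ^ 2 / k := by
      field_simp; ring
    rw [e]
    have : 0 ≤ t ^ 2 / k := by positivity
    linarith
  have ha : 0 < 1 - t := by linarith
  have hden : ∀ s ∈ Set.Icc (0 : ℝ) 1, 0 < (1 - t) * s + t / k * (1 - s) := by
    intro s hs
    rcases hs.1.eq_or_lt with h | h
    · rw [← h]; simp only [mul_zero, zero_add, sub_zero, mul_one]; positivity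
    · have h1 : 0 < (1 - t) * s := mul_pos ha h
      have h2 : 0 ≤ t / k * (1 - s) := mul_nonneg (by positivity) (by linarith [hs.2])
      linarith
  set g : (Fin (k + 1) → ℂ) → ℝ := fun w =>
    ((1 - t) * ‖w 0‖ ^ 2 + t / k * (1 - ‖w 0‖ ^ 2))⁻¹ with hg
  have hgc : ContinuousOn g {w | ∑ i, ‖w i‖ ^ 2 = 1} :=
    ContinuousOn.inv₀ (Continuous.continuousOn (by fun_prop))
      fun w hw => (hden _ (norm_sq_mem_Icc hw 0)).ne'
  have hginv : ∀ i ∈ J, ∀ j ∈ J, i ≠ j → ∀ a b w, star a * a + star b * b = 1 →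
      g (pairMap i j a b w) = g w := by
    intro i hi j hj _ a b w _
    have : pairMap i j a b w 0 = w 0 := by
      simp [pairMap, (h0J i hi).symm, (h0J j hj).symm]
    simp only [hg, this]
  have hJne : J.Nonempty := by
    rw [← Finset.card_pos, hJc]; exact hk
  have hmom := hν.integral_sq_diag_form hJne hgc hginv c hc0
  have hJs : ∀ w : Fin (k + 1) → ℂ, ∑ i, ‖w i‖ ^ 2 = 1 → ∑ i ∈ J, ‖w i‖ ^ 2 = 1 - ‖w 0‖ ^ 2 := by
    intro w hw
    rw [hsumJ fun i => ‖w i‖ ^ 2]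
    rw [Fin.sum_univ_succ] at hw
    linarith
  have h1 : ∫ w, diagChiSq (omegaSpectrum k r t) (omegaMeanSpectrum k t) w ∂ν
      = ∫ w, g w * (∑ i ∈ J, c i * ‖w i‖ ^ 2) ^ 2 ∂ν := by
    refine integral_congr_ae ?_
    filter_upwards [hν.ae_sphere] with w hw
    have e1 : ∑ i, omegaMeanSpectrum k t i * ‖w i‖ ^ 2
        = (1 - t) * ‖w 0‖ ^ 2 + t / k * (1 - ‖w 0‖ ^ 2) := by
      rw [Fin.sum_univ_succ, ← hJs w hw, hsumJ fun i => ‖w i‖ ^ 2, Finset.mul_sum]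
      simp [omegaMeanSpectrum]
    have e2 : ∑ i, c i * ‖w i‖ ^ 2 = ∑ i ∈ J, c i * ‖w i‖ ^ 2 := by
      rw [Fin.sum_univ_succ, hcz, hsumJ fun i => c i * ‖w i‖ ^ 2]; ring
    simp only [diagChiSq]
    rw [e1]
    simp only [hc] at e2 ⊢
    rw [e2, div_eq_mul_inv, mul_comm]
  have h2 : ∫ w, g w * (∑ i ∈ J, ‖w i‖ ^ 2) ^ 2 ∂ν
      ≤ ∫ w, (1 - ‖w 0‖ ^ 2) / (t / k + (1 - t) * ‖w 0‖ ^ 2) ∂ν := by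
    refine integral_mono_ae (hν.integrable_of_continuousOn (hgc.mul (by fun_prop)))
      (hν.integrable_of_continuousOn (Continuous.div (by fun_prop) (by fun_prop)
        fun w => by positivity).continuousOn) ?_
    filter_upwards [hν.ae_sphere] with w hw
    rw [hJs w hw]
    simp only [hg]
    have hs := norm_sq_mem_Icc hw 0
    generalize ‖w 0‖ ^ 2 = s at hs ⊢
    have hs0 := hs.1
    have hs1 : 0 ≤ 1 - s := by linarith [hs.2]
    rw [inv_mul_eq_div, div_le_div_iff₀ (hden s hs) (by positivity)]
    have e : (1 - s) * ((1 - t) * s + t / k * (1 - s)) - (1 - s) ^ 2 * (t / k + (1 - t) * s)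
        = (1 - s) * s * ((1 - t) * s) := by ring
    have : 0 ≤ (1 - s) * s * ((1 - t) * s) := by positivity
    linarith
  have h3 := hν.integral_inv_affine_le (a := 1 - t) (c := t / k) ha (by positivity)
  set L := Real.log (2 / t) with hL
  have hLlow : (2 / 3 : ℝ) ≤ L := by
    have h2 : Real.log 2 ≤ L := by
      refine Real.log_le_log (by norm_num) ?_
      rw [le_div_iff₀ ht]; linarith
    linarith [Real.log_two_gt_d9]
  have h4 : Real.log (1 + (1 - t) / (t / k * (k + 1))) ≤ L := by
    refine Real.log_le_log (by positivity) ?_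
    have e1 : (1 - t) / (t / k * (k + 1)) ≤ (1 - t) / t := by
      refine div_le_div_of_nonneg_left ha.le ht ?_
      rw [div_mul_eq_mul_div, le_div_iff₀ hk0]
      nlinarith
    have e2 : 1 + (1 - t) / t ≤ 2 / t := by
      rw [show 1 + (1 - t) / t = 1 / t by field_simp; ring]
      exact div_le_div_of_nonneg_right (by norm_num) ht.le
    linarith
  have h5 : k / (1 - t) * (1 + Real.log (1 + (1 - t) / (t / k * (k + 1)))) ≤ 4 * k * L := by
    rw [div_mul_eq_mul_div, div_le_iff₀ ha]
    have e : 1 + Real.log (1 + (1 - t) / (t / k * (k + 1))) ≤ 4 * L * (1 - t) := by nlinarith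
    calc _ ≤ k * (4 * L * (1 - t)) := mul_le_mul_of_nonneg_left e hk0.le
      _ = _ := by ring
  rw [h1, hmom, hJc]
  calc _ ≤ t ^ 2 / r / (k * (k + 1)) * (4 * k * L) :=
        mul_le_mul (div_le_div_of_nonneg_right hc2 (by positivity)) (h2.trans (h3.trans h5))
          (integral_nonneg_of_ae (by
            filter_upwards [hν.ae_sphere] with w hw
            exact mul_nonneg (inv_nonneg.mpr (hden _ (norm_sq_mem_Icc hw 0)).le) (sq_nonneg _)))
          (by positivity)
    _ = _ := by field_simp

end IsSphereLaw

/-! ### The normalized Haar measure on the unitary group -/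

noncomputable instance unitaryGroup.instMeasurableSpace (d : ℕ) :
    MeasurableSpace (Matrix.unitaryGroup (Fin d) ℂ) := borel _

instance unitaryGroup.instBorelSpace (d : ℕ) : BorelSpace (Matrix.unitaryGroup (Fin d) ℂ) := ⟨rfl⟩

instance unitaryGroup.instCompactSpace (d : ℕ) :
    CompactSpace (Matrix.unitaryGroup (Fin d) ℂ) := by
  refine isCompact_iff_compactSpace.mp ?_
  have hc : IsCompact (Set.univ.pi fun _ : Fin d => Set.univ.pi fun _ : Fin d =>
      Metric.closedBall (0 : ℂ) 1) :=
    isCompact_univ_pi fun _ => isCompact_univ_pi fun _ => isCompact_closedBall _ _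
  have hcl : IsClosed {U : Matrix (Fin d) (Fin d) ℂ | Uᴴ * U = 1} :=
    isClosed_eq (by fun_prop) continuous_const
  have he : ((Matrix.unitaryGroup (Fin d) ℂ : Submonoid (Matrix (Fin d) (Fin d) ℂ)) :
      Set (Matrix (Fin d) (Fin d) ℂ)) = {U : Matrix (Fin d) (Fin d) ℂ | Uᴴ * U = 1} := by
    ext U
    exact Matrix.mem_unitaryGroup_iff'
  refine IsCompact.of_isClosed_subset hc (he ▸ hcl) fun U hU i _ j _ => ?_
  rw [mem_closedBall_zero_iff]
  exact entry_norm_bound_of_unitary hU i j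

/-- The right-invariant probability measure on the unitary group. -/
noncomputable def unitaryHaar (d : ℕ) : Measure (Matrix.unitaryGroup (Fin d) ℂ) :=
  (Measure.haarMeasure ⊤).inv

instance unitaryHaar.instIsProbabilityMeasure (d : ℕ) : IsProbabilityMeasure (unitaryHaar d) := by
  constructor
  rw [unitaryHaar, Measure.inv_apply, Set.inv_univ]
  exact Measure.haarMeasure_self (K₀ := (⊤ : TopologicalSpace.PositiveCompacts
    (Matrix.unitaryGroup (Fin d) ℂ)))

instance unitaryHaar.instIsMulRightInvariant (d : ℕ) : (unitaryHaar d).IsMulRightInvariant := by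
  unfold unitaryHaar; infer_instance

theorem continuous_unitaryGroup_apply {d : ℕ} (i j : Fin d) :
    Continuous fun W : Matrix.unitaryGroup (Fin d) ℂ => (W : Matrix (Fin d) (Fin d) ℂ) i j :=
  continuous_subtype_val.matrix_elem i j

/-- A unit vector, seen in the random basis given by the columns of `W V`, is uniformly
distributed on the sphere. -/
theorem isSphereLaw_map_unitaryHaar {d : ℕ} (V : Matrix.unitaryGroup (Fin d) ℂ) {v : Fin d → ℂ}
    (hv : ∑ i, ‖v i‖ ^ 2 = 1) :
    IsSphereLaw ((unitaryHaar d).map fun W : Matrix.unitaryGroup (Fin d) ℂ =>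
      ((W * V : Matrix.unitaryGroup (Fin d) ℂ) : Matrix (Fin d) (Fin d) ℂ)ᴴ *ᵥ v) := by
  have hc : ∀ V : Matrix.unitaryGroup (Fin d) ℂ,
      Continuous fun W : Matrix.unitaryGroup (Fin d) ℂ =>
        ((W * V : Matrix.unitaryGroup (Fin d) ℂ) : Matrix (Fin d) (Fin d) ℂ)ᴴ *ᵥ v := fun V =>
    Continuous.matrix_mulVec
      (Continuous.matrix_conjTranspose (continuous_subtype_val.comp (continuous_mul_const V)))
      continuous_const
  -- by right invariance, `V` does not matter
  have hlaw : ∀ V : Matrix.unitaryGroup (Fin d) ℂ,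
      ((unitaryHaar d).map fun W : Matrix.unitaryGroup (Fin d) ℂ =>
        ((W * V : Matrix.unitaryGroup (Fin d) ℂ) : Matrix (Fin d) (Fin d) ℂ)ᴴ *ᵥ v)
      = (unitaryHaar d).map fun W : Matrix.unitaryGroup (Fin d) ℂ =>
        ((W * 1 : Matrix.unitaryGroup (Fin d) ℂ) : Matrix (Fin d) (Fin d) ℂ)ᴴ *ᵥ v := by
    intro V
    conv_rhs => rw [← map_mul_right_eq_self (unitaryHaar d) V]
    rw [Measure.map_map (hc 1).measurable (continuous_mul_const V).measurable]
    congr 1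
    funext W
    simp only [Function.comp, mul_one]
  refine ⟨Measure.isProbabilityMeasure_map (hc V).aemeasurable, fun X hX => ?_, ?_⟩
  · rw [Measure.map_map (by fun_prop) (hc V).measurable]
    have : ((fun w => X *ᵥ w) ∘ fun W : Matrix.unitaryGroup (Fin d) ℂ =>
        ((W * V : Matrix.unitaryGroup (Fin d) ℂ) : Matrix (Fin d) (Fin d) ℂ)ᴴ *ᵥ v)
        = fun W : Matrix.unitaryGroup (Fin d) ℂ =>
          ((W * (V * (⟨X, hX⟩ : Matrix.unitaryGroup (Fin d) ℂ)⁻¹) :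
            Matrix.unitaryGroup (Fin d) ℂ) : Matrix (Fin d) (Fin d) ℂ)ᴴ *ᵥ v := by
      funext W
      have e : (((⟨X, hX⟩ : Matrix.unitaryGroup (Fin d) ℂ)⁻¹ : Matrix.unitaryGroup (Fin d) ℂ) :
          Matrix (Fin d) (Fin d) ℂ) = Xᴴ := rfl
      simp only [Function.comp, Matrix.mulVec_mulVec, Submonoid.coe_mul, e,
        Matrix.conjTranspose_mul, Matrix.conjTranspose_conjTranspose, Matrix.mul_assoc]
    rw [this, hlaw, hlaw V]
  · rw [ae_map_iff (hc V).aemeasurable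
      (isClosed_eq (by fun_prop) continuous_const).measurableSet]
    refine Filter.Eventually.of_forall fun W => ?_
    rw [← Matrix.star_eq_conjTranspose, sum_norm_sq_unitary_mulVec, hv]
    exact Unitary.star_mem (W * V).2

/-! ### χ²-divergences of outcome distributions -/

theorem measurable_diagChiSq {d : ℕ} (a b : Fin d → ℝ) : Measurable (diagChiSq a b) := by
  unfold diagChiSq; fun_prop

theorem diagChiSq_smul {d : ℕ} (a b : Fin d → ℝ) (z : ℂ) (w : Fin d → ℂ) :
    diagChiSq a b (z • w) = ‖z‖ ^ 2 * diagChiSq a b w := by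
  by_cases hz : z = 0
  · simp [hz, diagChiSq]
  have hz' : ‖z‖ ≠ 0 := norm_ne_zero_iff.mpr hz
  have h : ∀ c : Fin d → ℝ, ∑ i, c i * ‖(z • w) i‖ ^ 2 = ‖z‖ ^ 2 * ∑ i, c i * ‖w i‖ ^ 2 := by
    intro c
    rw [Finset.mul_sum]
    refine Finset.sum_congr rfl fun i _ => ?_
    rw [Pi.smul_apply, smul_eq_mul, norm_mul]; ring
  rw [diagChiSq, h, h, diagChiSq, mul_pow, mul_div_mul_comm, sq (‖z‖ ^ 2),
    mul_div_assoc, div_self (pow_ne_zero 2 hz'), mul_one]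

theorem sq_div_le_of_abs_le {x y C : ℝ} (hy : 0 ≤ y) (h : |x| ≤ C * y) :
    x ^ 2 / y ≤ C ^ 2 * y := by
  rcases hy.eq_or_lt with rfl | hy
  · simp
  · rw [div_le_iff₀ hy]
    have := mul_self_le_mul_self (abs_nonneg x) h
    rw [abs_mul_abs_self] at this
    nlinarith

/-- `x² / y` is subadditive, with the convention `0² / 0 = 0`. -/
theorem sq_sum_div_sum_le {ι : Type*} (s : Finset ι) (x y : ι → ℝ) (hy : ∀ i ∈ s, 0 ≤ y i)
    (hxy : ∀ i ∈ s, y i = 0 → x i = 0) :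
    (∑ i ∈ s, x i) ^ 2 / ∑ i ∈ s, y i ≤ ∑ i ∈ s, x i ^ 2 / y i := by
  have hn : ∀ i ∈ s, 0 ≤ x i ^ 2 / y i := fun i hi => div_nonneg (sq_nonneg _) (hy i hi)
  rcases (Finset.sum_nonneg hy).eq_or_lt with h | h
  · rw [← h, div_zero]; exact Finset.sum_nonneg hn
  · rw [div_le_iff₀ h]
    refine Finset.sum_sq_le_sum_mul_sum_of_sq_le_mul s hn hy fun i hi => ?_
    by_cases h0 : y i = 0
    · simp [hxy i hi h0, h0]
    · rw [div_mul_cancel₀ _ h0]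

/-- A pair of spectra for which the relative density of `a` with respect to `b` is bounded. -/
structure DominatedSpectra {d : ℕ} (a b : Fin d → ℝ) (C : ℝ) : Prop where
  nonneg_left : ∀ i, 0 ≤ a i
  nonneg_right : ∀ i, 0 ≤ b i
  one_le : 1 ≤ C
  le_mul : ∀ i, a i ≤ C * b i

namespace DominatedSpectra

variable {d : ℕ} {a b : Fin d → ℝ} {C : ℝ}

theorem abs_sub_le (h : DominatedSpectra a b C) (i : Fin d) : |a i - b i| ≤ C * b i := by
  have h1 := h.nonneg_left i
  have h2 := h.nonneg_right i
  have h3 := h.le_mul i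
  have h4 := h.one_le
  rw [abs_le]; constructor <;> nlinarith

theorem abs_sum_le (h : DominatedSpectra a b C) (w : Fin d → ℂ) :
    |∑ i, (a i - b i) * ‖w i‖ ^ 2| ≤ C * ∑ i, b i * ‖w i‖ ^ 2 := by
  rw [Finset.mul_sum]
  refine (Finset.abs_sum_le_sum_abs _ _).trans (Finset.sum_le_sum fun i _ => ?_)
  rw [abs_mul, abs_of_nonneg (sq_nonneg ‖w i‖), ← mul_assoc]
  exact mul_le_mul_of_nonneg_right (h.abs_sub_le i) (sq_nonneg _)

theorem sum_right_nonneg (h : DominatedSpectra a b C) (w : Fin d → ℂ) :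
    0 ≤ ∑ i, b i * ‖w i‖ ^ 2 :=
  Finset.sum_nonneg fun i _ => mul_nonneg (h.nonneg_right i) (sq_nonneg _)

theorem diagChiSq_nonneg (h : DominatedSpectra a b C) (w : Fin d → ℂ) : 0 ≤ diagChiSq a b w :=
  div_nonneg (sq_nonneg _) (h.sum_right_nonneg w)

theorem diagChiSq_le (h : DominatedSpectra a b C) {w : Fin d → ℂ} (hw : ∑ i, ‖w i‖ ^ 2 = 1) :
    diagChiSq a b w ≤ C ^ 2 * ∑ i, b i := by
  refine (sq_div_le_of_abs_le (h.sum_right_nonneg w) (h.abs_sum_le w)).trans ?_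
  refine mul_le_mul_of_nonneg_left (Finset.sum_le_sum fun i _ => ?_) (sq_nonneg _)
  exact mul_le_of_le_one_right (h.nonneg_right i) (IsSphereLaw.norm_sq_le_one hw i)

theorem integrable_diagChiSq (h : DominatedSpectra a b C) {ν : Measure (Fin d → ℂ)}
    (hν : IsSphereLaw ν) : Integrable (diagChiSq a b) ν := by
  have := hν.prob
  refine Integrable.of_bound (measurable_diagChiSq a b).aestronglyMeasurable
    (C ^ 2 * ∑ i, b i) ?_
  filter_upwards [hν.ae_sphere] with w hw
  rw [Real.norm_of_nonneg (h.diagChiSq_nonneg w)]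
  exact h.diagChiSq_le hw

/-- The mean of `diagChiSq` for a vector of arbitrary length in a Haar random basis. -/
theorem integral_haar_diagChiSq_le (h : DominatedSpectra a b C) {κ : ℝ}
    (hκ : ∀ ν : Measure (Fin d → ℂ), IsSphereLaw ν → ∫ w, diagChiSq a b w ∂ν ≤ κ)
    (V : Matrix.unitaryGroup (Fin d) ℂ) (v : Fin d → ℂ) :
    Integrable (fun W : Matrix.unitaryGroup (Fin d) ℂ => diagChiSq a b
      (((W * V : Matrix.unitaryGroup (Fin d) ℂ) : Matrix (Fin d) (Fin d) ℂ)ᴴ *ᵥ v))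
      (unitaryHaar d) ∧
    ∫ W : Matrix.unitaryGroup (Fin d) ℂ, diagChiSq a b
      (((W * V : Matrix.unitaryGroup (Fin d) ℂ) : Matrix (Fin d) (Fin d) ℂ)ᴴ *ᵥ v)
      ∂unitaryHaar d ≤ κ * ∑ i, ‖v i‖ ^ 2 := by
  by_cases hv : v = 0
  · subst hv; simp [diagChiSq]
  set N := ∑ i, ‖v i‖ ^ 2 with hN
  have hNpos : 0 < N := by
    obtain ⟨i, hi⟩ := Function.ne_iff.mp hv
    exact Finset.sum_pos' (fun _ _ => sq_nonneg _)
      ⟨i, Finset.mem_univ i, pow_pos (norm_pos_iff.mpr hi) 2⟩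
  have hs : Real.sqrt N ≠ 0 := (Real.sqrt_pos.mpr hNpos).ne'
  set u : Fin d → ℂ := ((Real.sqrt N : ℂ))⁻¹ • v with hu
  have hvu : v = (Real.sqrt N : ℂ) • u := by
    rw [hu, smul_smul, mul_inv_cancel₀ (by exact_mod_cast hs), one_smul]
  have hnorm : ‖(Real.sqrt N : ℂ)‖ ^ 2 = N := by
    rw [Complex.norm_real, Real.norm_eq_abs, sq_abs, Real.sq_sqrt hNpos.le]
  have hu1 : ∑ i, ‖u i‖ ^ 2 = 1 := by
    have : ∀ i, ‖u i‖ ^ 2 = N⁻¹ * ‖v i‖ ^ 2 := fun i => by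
      rw [hu, Pi.smul_apply, smul_eq_mul, norm_mul, mul_pow, norm_inv, inv_pow, hnorm]
    simp only [this, ← Finset.mul_sum, ← hN]
    exact inv_mul_cancel₀ hNpos.ne'
  have hlaw := isSphereLaw_map_unitaryHaar V hu1
  have hm : Measurable fun W : Matrix.unitaryGroup (Fin d) ℂ =>
      ((W * V : Matrix.unitaryGroup (Fin d) ℂ) : Matrix (Fin d) (Fin d) ℂ)ᴴ *ᵥ u :=
    (Continuous.matrix_mulVec (Continuous.matrix_conjTranspose
      (continuous_subtype_val.comp (continuous_mul_const V))) continuous_const).measurable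
  have hint := (h.integrable_diagChiSq hlaw).comp_measurable hm
  have hle := hκ _ hlaw
  rw [integral_map hm.aemeasurable (measurable_diagChiSq a b).aestronglyMeasurable] at hle
  have hscale : ∀ Z : Matrix (Fin d) (Fin d) ℂ, diagChiSq a b (Zᴴ *ᵥ v)
      = N * diagChiSq a b (Zᴴ *ᵥ u) := fun Z => by
    rw [hvu, Matrix.mulVec_smul, diagChiSq_smul, hnorm]
  simp only [hscale]
  refine ⟨hint.const_mul N, ?_⟩
  rw [integral_const_mul, mul_comm κ]
  exact mul_le_mul_of_nonneg_left hle hNpos.le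

end DominatedSpectra

/-- The state with spectrum `a` and eigenbasis the columns of `Z`. -/
def spectralState {d : ℕ} (a : Fin d → ℝ) (Z : Matrix (Fin d) (Fin d) ℂ) :
    Matrix (Fin d) (Fin d) ℂ :=
  Z * Matrix.diagonal (fun i => (a i : ℂ)) * Zᴴ

theorem trace_spectralState_mul {d : ℕ} (a : Fin d → ℝ) (Z B : Matrix (Fin d) (Fin d) ℂ) :
    (spectralState a Z * (Bᴴ * B)).trace
      = ((∑ l, ∑ i, a i * ‖(Zᴴ *ᵥ fun x => star (B l x)) i‖ ^ 2 : ℝ) : ℂ) := by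
  have h1 : (spectralState a Z * (Bᴴ * B)).trace
      = ((B * Z) * Matrix.diagonal (fun i => (a i : ℂ)) * (B * Z)ᴴ).trace := by
    rw [spectralState, ← Matrix.mul_assoc, Matrix.trace_mul_comm, Matrix.conjTranspose_mul]
    simp only [Matrix.mul_assoc]
  rw [h1, Matrix.trace, Complex.ofReal_sum]
  refine Finset.sum_congr rfl fun l _ => ?_
  rw [Matrix.diag_apply, Matrix.mul_apply, Complex.ofReal_sum]
  refine Finset.sum_congr rfl fun i _ => ?_
  have h2 : (Zᴴ *ᵥ fun x => star (B l x)) i = star ((B * Z) l i) := by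
    simp only [Matrix.mulVec, dotProduct, Matrix.conjTranspose_apply, Matrix.mul_apply, star_sum,
      star_mul']
    exact Finset.sum_congr rfl fun x _ => mul_comm _ _
  rw [h2, norm_star, Matrix.mul_diagonal, Matrix.conjTranspose_apply, mul_comm _ (a i : ℂ),
    mul_assoc]
  have h3 : (B * Z) l i * star ((B * Z) l i) = ((‖(B * Z) l i‖ ^ 2 : ℝ) : ℂ) := by
    rw [Complex.ofReal_pow]; exact Complex.mul_conj' _
  rw [h3, ← Complex.ofReal_mul]

theorem trace_spectralState_mul_re {d : ℕ} (a : Fin d → ℝ) (Z B : Matrix (Fin d) (Fin d) ℂ) :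
    (spectralState a Z * (Bᴴ * B)).trace.re
      = ∑ l, ∑ i, a i * ‖(Zᴴ *ᵥ fun x => star (B l x)) i‖ ^ 2 := by
  rw [trace_spectralState_mul, Complex.ofReal_re]

theorem trace_conjTranspose_mul_self_re {d : ℕ} (B : Matrix (Fin d) (Fin d) ℂ) :
    (Bᴴ * B).trace.re = ∑ l, ∑ i, ‖star (B l i)‖ ^ 2 := by
  have h := trace_spectralState_mul_re (fun _ => 1) (1 : Matrix (Fin d) (Fin d) ℂ) B
  simpa [spectralState] using h

theorem exists_conjTranspose_mul_self {d : ℕ} {M : Matrix (Fin d) (Fin d) ℂ}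
    (hM : M.PosSemidef) : ∃ B : Matrix (Fin d) (Fin d) ℂ, M = Bᴴ * B :=
  CStarAlgebra.nonneg_iff_eq_star_mul_self.mp hM.nonneg

/-- The mean over a Haar random basis of the χ²-divergence density of one POVM element `M`.
Writing `M` as a sum of rank one operators `|v⟩⟨v|` reduces it to `diagChiSq`, by convexity
of `x² / y`. -/
theorem DominatedSpectra.lintegral_chiSq_le {d : ℕ} {a b : Fin d → ℝ} {C κ : ℝ}
    (h : DominatedSpectra a b C)
    (hκ : ∀ ν : Measure (Fin d → ℂ), IsSphereLaw ν → ∫ w, diagChiSq a b w ∂ν ≤ κ)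
    (V : Matrix.unitaryGroup (Fin d) ℂ) {M : Matrix (Fin d) (Fin d) ℂ} (hM : M.PosSemidef) :
    ∫⁻ W : Matrix.unitaryGroup (Fin d) ℂ, ENNReal.ofReal
      (((spectralState a (W * V : Matrix.unitaryGroup (Fin d) ℂ) * M).trace.re
        - (spectralState b (W * V : Matrix.unitaryGroup (Fin d) ℂ) * M).trace.re) ^ 2
        / (spectralState b (W * V : Matrix.unitaryGroup (Fin d) ℂ) * M).trace.re) ∂unitaryHaar d
      ≤ ENNReal.ofReal (κ * M.trace.re) := by
  obtain ⟨B, rfl⟩ := exists_conjTranspose_mul_self hM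
  have hl := fun l => h.integral_haar_diagChiSq_le hκ V (fun x => star (B l x))
  have hpt : ∀ Z : Matrix (Fin d) (Fin d) ℂ,
      ((spectralState a Z * (Bᴴ * B)).trace.re - (spectralState b Z * (Bᴴ * B)).trace.re) ^ 2
        / (spectralState b Z * (Bᴴ * B)).trace.re
      ≤ ∑ l, diagChiSq a b (Zᴴ *ᵥ fun x => star (B l x)) := by
    intro Z
    rw [trace_spectralState_mul_re, trace_spectralState_mul_re, ← Finset.sum_sub_distrib]
    simp only [← Finset.sum_sub_distrib, ← sub_mul]
    refine sq_sum_div_sum_le _ _ _ (fun l _ => h.sum_right_nonneg _) fun l _ h0 => ?_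
    have := h.abs_sum_le (Zᴴ *ᵥ fun x => star (B l x))
    rw [h0, mul_zero] at this
    exact abs_nonpos_iff.mp this
  calc _ ≤ ∫⁻ W : Matrix.unitaryGroup (Fin d) ℂ, ENNReal.ofReal (∑ l, diagChiSq a b
        (((W * V : Matrix.unitaryGroup (Fin d) ℂ) : Matrix (Fin d) (Fin d) ℂ)ᴴ *ᵥ
          fun x => star (B l x))) ∂unitaryHaar d :=
        lintegral_mono fun W => ENNReal.ofReal_le_ofReal (hpt _)
    _ = ENNReal.ofReal (∫ W : Matrix.unitaryGroup (Fin d) ℂ, ∑ l, diagChiSq a b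
        (((W * V : Matrix.unitaryGroup (Fin d) ℂ) : Matrix (Fin d) (Fin d) ℂ)ᴴ *ᵥ
          fun x => star (B l x)) ∂unitaryHaar d) :=
        (ofReal_integral_eq_lintegral_ofReal (integrable_finsetSum _ fun l _ => (hl l).1)
          (Filter.Eventually.of_forall fun W =>
            Finset.sum_nonneg fun l _ => h.diagChiSq_nonneg _)).symm
    _ ≤ _ := by
        refine ENNReal.ofReal_le_ofReal ?_
        rw [integral_finsetSum _ fun l _ => (hl l).1, trace_conjTranspose_mul_self_re,
          Finset.mul_sum]
        exact Finset.sum_le_sum fun l _ => (hl l).2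

/-! ### Relative entropy and its tensorization -/

/-- The integrand of the relative entropy `D(p‖q)`, normalized so as to be non-negative
pointwise. -/
noncomputable def relEntropyDensity (p q : ℝ) : ℝ := p * Real.log (p / q) - p + q

theorem sub_le_mul_log_div {p q : ℝ} (hp : 0 ≤ p) (hq : 0 ≤ q) (hpq : q = 0 → p = 0) :
    p - q ≤ p * Real.log (p / q) := by
  rcases hp.eq_or_lt with rfl | hp
  · simpa using hq
  · have hq' : 0 < q := hq.lt_of_ne fun h => hp.ne' (hpq h.symm)
    have h1 := Real.log_le_sub_one_of_pos (div_pos hq' hp)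
    have h2 : Real.log (p / q) = -Real.log (q / p) := by rw [← Real.log_inv, inv_div]
    have h3 : p * (q / p) = q := by field_simp
    rw [h2]
    nlinarith

theorem relEntropyDensity_nonneg {p q : ℝ} (hp : 0 ≤ p) (hq : 0 ≤ q) (hpq : q = 0 → p = 0) :
    0 ≤ relEntropyDensity p q := by
  have := sub_le_mul_log_div hp hq hpq
  unfold relEntropyDensity; linarith

theorem relEntropyDensity_le_chiSq {p q : ℝ} (hp : 0 ≤ p) (hq : 0 ≤ q) (hpq : q = 0 → p = 0) :
    relEntropyDensity p q ≤ (p - q) ^ 2 / q := by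
  rcases hq.eq_or_lt with h | hq
  · simp [relEntropyDensity, ← h, hpq h.symm]
  · have h1 : p * Real.log (p / q) ≤ p * (p / q - 1) := by
      rcases hp.eq_or_lt with rfl | hp
      · simp
      · exact mul_le_mul_of_nonneg_left (Real.log_le_sub_one_of_pos (div_pos hp hq)) hp.le
    have h2 : (p - q) ^ 2 / q = p * (p / q - 1) - p + q := by field_simp; ring
    rw [h2, relEntropyDensity]; linarith

/-- For every fixed `q`, the pointwise Holevo information of the densities `p θ` is at most
the mean of their relative entropy densities with respect to `q`. -/
theorem ofReal_negMulLog_sub_le {Θ : Type*} [MeasurableSpace Θ] (π : Measure Θ)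
    [IsProbabilityMeasure π] {p : Θ → ℝ} (hp : Measurable p) {q K : ℝ} (hp0 : ∀ θ, 0 ≤ p θ)
    (hq0 : 0 ≤ q) (hK : ∀ θ, p θ ≤ K * q) :
    ENNReal.ofReal (Real.negMulLog (∫ θ, p θ ∂π) - ∫ θ, Real.negMulLog (p θ) ∂π)
      ≤ ∫⁻ θ, ENNReal.ofReal (relEntropyDensity (p θ) q) ∂π := by
  have hpq : ∀ θ, q = 0 → p θ = 0 := fun θ h =>
    le_antisymm (by simpa [h] using hK θ) (hp0 θ)
  have ip : Integrable p π := by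
    refine Integrable.of_bound hp.aestronglyMeasurable (K * q)
      (Filter.Eventually.of_forall fun θ => ?_)
    rw [Real.norm_of_nonneg (hp0 θ)]; exact hK θ
  have iη : Integrable (fun θ => Real.negMulLog (p θ)) π := by
    obtain ⟨R, hR⟩ := (isCompact_Icc (a := (0 : ℝ)) (b := K * q)).exists_bound_of_continuousOn
      Real.continuous_negMulLog.continuousOn
    exact Integrable.of_bound (Real.continuous_negMulLog.measurable.comp hp).aestronglyMeasurable R
      (Filter.Eventually.of_forall fun θ => hR _ ⟨hp0 θ, hK θ⟩)
  have hg : ∀ θ, relEntropyDensity (p θ) q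
      = -Real.negMulLog (p θ) - (Real.log q + 1) * p θ + q := by
    intro θ
    unfold relEntropyDensity Real.negMulLog
    by_cases h : p θ = 0
    · simp [h]
    · rw [Real.log_div h fun h' => h (hpq θ h')]; ring
  have i1 : Integrable (fun θ => -Real.negMulLog (p θ) - (Real.log q + 1) * p θ) π :=
    iη.neg.sub (ip.const_mul _)
  have ig : Integrable (fun θ => relEntropyDensity (p θ) q) π := by
    simp only [hg]; exact i1.add (integrable_const q)
  rw [← ofReal_integral_eq_lintegral_ofReal ig (Filter.Eventually.of_forall fun θ =>
    relEntropyDensity_nonneg (hp0 θ) hq0 (hpq θ))]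
  refine ENNReal.ofReal_le_ofReal ?_
  have e : ∫ θ, relEntropyDensity (p θ) q ∂π
      = -∫ θ, Real.negMulLog (p θ) ∂π - (Real.log q + 1) * ∫ θ, p θ ∂π + q := by
    simp only [hg]
    have i3 : Integrable (fun θ => -Real.negMulLog (p θ)) π := iη.neg
    rw [integral_add i1 (integrable_const q), integral_sub i3 (ip.const_mul _),
      integral_neg, integral_const_mul, integral_const]
    simp
  rw [e]
  set P := ∫ θ, p θ ∂π with hP
  have hP0 : 0 ≤ P := integral_nonneg hp0
  have hPq : q = 0 → P = 0 := fun h => by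
    rw [hP, integral_congr_ae (Filter.Eventually.of_forall fun θ => hpq θ h)]; simp
  have h1 := relEntropyDensity_nonneg hP0 hq0 hPq
  have h2 : relEntropyDensity P q = -Real.negMulLog P - (Real.log q + 1) * P + q := by
    unfold relEntropyDensity Real.negMulLog
    by_cases h : P = 0
    · simp [h]
    · rw [Real.log_div h fun h' => h (hPq h')]; ring
  linarith

/-- A pair of probability densities with respect to `μ` with bounded relative density. -/
structure DominatedDensities {Ω : Type*} [MeasurableSpace Ω] (μ : Measure Ω) (p q : Ω → ℝ)
    (C : ℝ) : Prop where
  measurable_left : Measurable p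
  measurable_right : Measurable q
  nonneg_left : ∀ x, 0 ≤ p x
  nonneg_right : ∀ x, 0 ≤ q x
  le_mul : ∀ x, p x ≤ C * q x
  one_le : 1 ≤ C
  integrable_left : Integrable p μ
  integrable_right : Integrable q μ
  integral_left : ∫ x, p x ∂μ = 1
  integral_right : ∫ x, q x ∂μ = 1

namespace DominatedDensities

section single

variable {Ω : Type*} [MeasurableSpace Ω] {μ : Measure Ω} {p q : Ω → ℝ} {C : ℝ}

theorem eq_zero (h : DominatedDensities μ p q C) {x : Ω} (hq : q x = 0) : p x = 0 :=
  le_antisymm (by simpa [hq] using h.le_mul x) (h.nonneg_left x)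

theorem integrable_chiSq (h : DominatedDensities μ p q C) :
    Integrable (fun x => (p x - q x) ^ 2 / q x) μ := by
  refine (h.integrable_right.const_mul (C ^ 2)).mono'
    (((h.measurable_left.sub h.measurable_right).pow_const 2).div
      h.measurable_right).aestronglyMeasurable (Filter.Eventually.of_forall fun x => ?_)
  have h1 := h.nonneg_left x
  have h2 := h.nonneg_right x
  have h3 := h.le_mul x
  have h4 := h.one_le
  rw [Real.norm_of_nonneg (div_nonneg (sq_nonneg _) h2)]
  refine sq_div_le_of_abs_le h2 ?_
  rw [abs_le]; constructor <;> nlinarith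

theorem integrable_mul_log (h : DominatedDensities μ p q C) :
    Integrable (fun x => p x * Real.log (p x / q x)) μ := by
  refine ((h.integrable_chiSq.add h.integrable_left).add h.integrable_right).mono'
    (h.measurable_left.mul
      (h.measurable_left.div h.measurable_right).log).aestronglyMeasurable
    (Filter.Eventually.of_forall fun x => ?_)
  have h1 := h.nonneg_left x
  have h2 := h.nonneg_right x
  have h5 := sub_le_mul_log_div h1 h2 h.eq_zero
  have h6 := relEntropyDensity_le_chiSq h1 h2 h.eq_zero
  have h7 : 0 ≤ (p x - q x) ^ 2 / q x := div_nonneg (sq_nonneg _) h2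
  unfold relEntropyDensity at h6
  simp only [Pi.add_apply]
  rw [Real.norm_eq_abs, abs_le]; constructor <;> linarith

theorem integral_mul_log_le (h : DominatedDensities μ p q C) :
    ∫ x, p x * Real.log (p x / q x) ∂μ ≤ ∫ x, (p x - q x) ^ 2 / q x ∂μ := by
  have e : ∫ x, p x * Real.log (p x / q x) ∂μ = ∫ x, relEntropyDensity (p x) (q x) ∂μ := by
    unfold relEntropyDensity
    have i1 : Integrable (fun x => p x * Real.log (p x / q x) - p x) μ :=
      h.integrable_mul_log.sub h.integrable_left
    rw [integral_add i1 h.integrable_right, integral_sub h.integrable_mul_log h.integrable_left,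
      h.integral_left, h.integral_right]
    ring
  rw [e]
  refine integral_mono ?_ h.integrable_chiSq fun x =>
    relEntropyDensity_le_chiSq (h.nonneg_left x) (h.nonneg_right x) h.eq_zero
  exact (h.integrable_mul_log.sub h.integrable_left).add h.integrable_right

end single

/-- The relative entropy of product densities is the sum of the relative entropies, each of which
is bounded by the χ²-divergence. -/
theorem lintegral_relEntropyDensity_pi_le {ι : Type*} [Fintype ι] [DecidableEq ι]
    {Ω : ι → Type*} [∀ a, MeasurableSpace (Ω a)] {μ : ∀ a, Measure (Ω a)}
    [∀ a, SigmaFinite (μ a)] {p q : ∀ a, Ω a → ℝ} {C : ℝ}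
    (h : ∀ a, DominatedDensities (μ a) (p a) (q a) C) :
    ∫⁻ x, ENNReal.ofReal (relEntropyDensity (∏ a, p a (x a)) (∏ a, q a (x a))) ∂Measure.pi μ
      ≤ ∑ a, ∫⁻ y, ENNReal.ofReal ((p a y - q a y) ^ 2 / q a y) ∂μ a := by
  -- `p ln (p / q) = ∑ₐ ∏_b f a b`, with the logarithm of the factor `a` placed in factor `b = a`
  set f : ∀ a b, Ω b → ℝ := fun a b y =>
    p b y * (if b = a then Real.log (p b y / q b y) else 1) with hf
  have hlog : ∀ x : ∀ a, Ω a, (∏ a, p a (x a)) * Real.log ((∏ a, p a (x a)) / ∏ a, q a (x a))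
      = ∑ a, ∏ b, f a b (x b) := by
    intro x
    simp only [hf, Finset.prod_mul_distrib, Finset.prod_ite_eq', Finset.mem_univ, if_true,
      ← Finset.mul_sum]
    by_cases h0 : ∏ a, p a (x a) = 0
    · simp [h0]
    · have hp : ∀ a ∈ Finset.univ, p a (x a) ≠ 0 := Finset.prod_ne_zero_iff.mp h0
      rw [← Finset.prod_div_distrib, Real.log_prod]
      intro a ha
      exact div_ne_zero (hp a ha) fun hq => hp a ha ((h a).eq_zero hq)
  have hfi : ∀ a b, Integrable (f a b) (μ b) := by
    intro a b
    by_cases hab : b = a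
    · simp only [hf, if_pos hab]; exact (h b).integrable_mul_log
    · simp only [hf, if_neg hab, mul_one]; exact (h b).integrable_left
  have hfint : ∀ a b, ∫ y, f a b y ∂μ b
      = if b = a then ∫ y, p b y * Real.log (p b y / q b y) ∂μ b else 1 := by
    intro a b
    by_cases hab : b = a
    · simp only [hf, if_pos hab]
    · simp only [hf, if_neg hab, mul_one]; exact (h b).integral_left
  have ip : Integrable (fun x : ∀ a, Ω a => ∏ a, p a (x a)) (Measure.pi μ) :=
    Integrable.fintype_prod_dep fun a => (h a).integrable_left
  have iq : Integrable (fun x : ∀ a, Ω a => ∏ a, q a (x a)) (Measure.pi μ) :=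
    Integrable.fintype_prod_dep fun a => (h a).integrable_right
  have iF : ∀ a, Integrable (fun x : ∀ a, Ω a => ∏ b, f a b (x b)) (Measure.pi μ) := fun a =>
    Integrable.fintype_prod_dep (hfi a)
  have iL : Integrable (fun x : ∀ a, Ω a => ∑ a, ∏ b, f a b (x b)) (Measure.pi μ) :=
    integrable_finsetSum _ fun a _ => iF a
  have i1 : Integrable (fun x : ∀ a, Ω a => ∑ a, ∏ b, f a b (x b) - ∏ a, p a (x a))
    (Measure.pi μ) := iL.sub ip
  have i2 : Integrable (fun x : ∀ a, Ω a =>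
      relEntropyDensity (∏ a, p a (x a)) (∏ a, q a (x a))) (Measure.pi μ) := by
    simp only [relEntropyDensity, hlog]; exact i1.add iq
  have hnn : ∀ x : ∀ a, Ω a, 0 ≤ relEntropyDensity (∏ a, p a (x a)) (∏ a, q a (x a)) := by
    intro x
    refine relEntropyDensity_nonneg (Finset.prod_nonneg fun a _ => (h a).nonneg_left _)
      (Finset.prod_nonneg fun a _ => (h a).nonneg_right _) fun h0 => ?_
    obtain ⟨a, ha, ha0⟩ := Finset.prod_eq_zero_iff.mp h0
    exact Finset.prod_eq_zero ha ((h a).eq_zero ha0)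
  have hval : ∫ x, relEntropyDensity (∏ a, p a (x a)) (∏ a, q a (x a)) ∂Measure.pi μ
      = ∑ a, ∫ y, p a y * Real.log (p a y / q a y) ∂μ a := by
    simp only [relEntropyDensity, hlog]
    rw [integral_add i1 iq, integral_sub iL ip, integral_finsetSum _ fun a _ => iF a,
      integral_fintype_prod_eq_prod, integral_fintype_prod_eq_prod]
    simp only [(h _).integral_left, (h _).integral_right, Finset.prod_const_one,
      sub_add_cancel]
    refine Finset.sum_congr rfl fun a _ => ?_
    rw [integral_fintype_prod_eq_prod]
    simp only [hfint, Finset.prod_ite_eq', Finset.mem_univ, if_true]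
  have hχ : ∀ a y, 0 ≤ (p a y - q a y) ^ 2 / q a y := fun a y =>
    div_nonneg (sq_nonneg _) ((h a).nonneg_right y)
  calc _ = ENNReal.ofReal (∑ a, ∫ y, p a y * Real.log (p a y / q a y) ∂μ a) := by
        rw [← hval, ofReal_integral_eq_lintegral_ofReal i2 (Filter.Eventually.of_forall hnn)]
    _ ≤ ENNReal.ofReal (∑ a, ∫ y, (p a y - q a y) ^ 2 / q a y ∂μ a) :=
        ENNReal.ofReal_le_ofReal (Finset.sum_le_sum fun a _ => (h a).integral_mul_log_le)
    _ = ∑ a, ENNReal.ofReal (∫ y, (p a y - q a y) ^ 2 / q a y ∂μ a) :=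
        ENNReal.ofReal_sum_of_nonneg fun a _ => integral_nonneg (hχ a)
    _ = _ := Finset.sum_congr rfl fun a _ =>
        ofReal_integral_eq_lintegral_ofReal (h a).integrable_chiSq
          (Filter.Eventually.of_forall (hχ a))

end DominatedDensities

/-! ### Outcome distributions -/

theorem trace_tensorMatrix_mul {n d : ℕ} (A B : Fin n → Matrix (Fin d) (Fin d) ℂ) :
    (tensorMatrix A * tensorMatrix B).trace = ∏ a, (A a * B a).trace := by
  simp only [Matrix.trace, Matrix.diag_apply, Matrix.mul_apply, tensorMatrix, Matrix.of_apply,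
    ← Finset.prod_mul_distrib]
  rw [Finset.prod_univ_sum]
  simp only [Fintype.piFinset_univ]
  refine Finset.sum_congr rfl fun i _ => ?_
  rw [Finset.prod_univ_sum]
  simp only [Fintype.piFinset_univ]

theorem outcome_tensorPow_spectralState {n d : ℕ} {Ω : Fin n → Type*}
    [∀ a, MeasurableSpace (Ω a)] (M : ∀ a, POVM (Ω a) (Fin d)) (a : Fin d → ℝ)
    (Z : Matrix (Fin d) (Fin d) ℂ) (x : ∀ a, Ω a) :
    (POVM.tensor M).outcome (tensorPow n (spectralState a Z)) x
      = ∏ l, (M l).outcome (spectralState a Z) (x l) := by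
  have hre : ∀ l, (spectralState a Z * (M l).density (x l)).trace
      = (((M l).outcome (spectralState a Z) (x l) : ℝ) : ℂ) := by
    intro l
    obtain ⟨B, hB⟩ := exists_conjTranspose_mul_self ((M l).posSemidef_density (x l))
    rw [POVM.outcome, hB, trace_spectralState_mul, Complex.ofReal_re]
  have h : (tensorPow n (spectralState a Z) * (POVM.tensor M).density x).trace
      = ((∏ l, (M l).outcome (spectralState a Z) (x l) : ℝ) : ℂ) := by
    rw [Complex.ofReal_prod, ← Finset.prod_congr rfl fun l _ => hre l]
    exact trace_tensorMatrix_mul _ _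
  rw [POVM.outcome, h, Complex.ofReal_re]

theorem measurable_spectralState {X : Type*} [MeasurableSpace X] {d : ℕ} (a : Fin d → ℝ)
    {Z : X → Matrix (Fin d) (Fin d) ℂ} (hZ : ∀ i j, Measurable fun x => Z x i j) (i j : Fin d) :
    Measurable fun x => spectralState a (Z x) i j := by
  simp only [spectralState, Matrix.mul_apply (M := _ * _), Matrix.mul_diagonal,
    Matrix.conjTranspose_apply]
  exact Finset.measurable_sum _ fun k _ =>
    ((hZ i k).mul_const _).mul (continuous_star.measurable.comp (hZ j k))

theorem measurable_outcome_spectralState {X Ω : Type*} [MeasurableSpace X] [MeasurableSpace Ω]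
    {d : ℕ} (M : POVM Ω (Fin d)) (a : Fin d → ℝ) {Z : X → Matrix (Fin d) (Fin d) ℂ}
    (hZ : ∀ i j, Measurable fun x => Z x i j) {y : X → Ω} (hy : Measurable y) :
    Measurable fun x => M.outcome (spectralState a (Z x)) (y x) := by
  simp only [POVM.outcome, Matrix.trace, Matrix.diag_apply, Matrix.mul_apply]
  exact Complex.measurable_re.comp (Finset.measurable_sum _ fun i _ =>
    Finset.measurable_sum _ fun j _ => (measurable_spectralState a hZ i j).mul
      ((M.measurable_density j i).comp hy))

theorem POVM.integrable_outcome {Ω : Type*} [MeasurableSpace Ω] {d : ℕ} (M : POVM Ω (Fin d))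
    (ρ : Matrix (Fin d) (Fin d) ℂ) : Integrable (M.outcome ρ) M.ref := by
  have h : ∀ x, M.outcome ρ x = (∑ i, ∑ j, ρ i j * M.density x j i).re := fun x => by
    simp only [POVM.outcome, Matrix.trace, Matrix.diag_apply, Matrix.mul_apply]
  rw [funext h]
  exact (integrable_finsetSum _ fun i _ => integrable_finsetSum _ fun j _ =>
    (M.integrable_density j i).const_mul _).re

theorem POVM.integral_outcome {Ω : Type*} [MeasurableSpace Ω] {d : ℕ} (M : POVM Ω (Fin d))
    (ρ : Matrix (Fin d) (Fin d) ℂ) : ∫ x, M.outcome ρ x ∂M.ref = ρ.trace.re := by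
  simp only [POVM.outcome, Matrix.trace, Matrix.diag_apply, Matrix.mul_apply]
  have hi : ∀ i j, Integrable (fun x => ρ i j * M.density x j i) M.ref := fun i j =>
    (M.integrable_density j i).const_mul _
  have h : ∫ x, ∑ i, ∑ j, ρ i j * M.density x j i ∂M.ref = ∑ i, ρ i i := by
    rw [integral_finsetSum _ fun i _ => integrable_finsetSum _ fun j _ => hi i j]
    refine Finset.sum_congr rfl fun i _ => ?_
    rw [integral_finsetSum _ fun j _ => hi i j]
    simp only [integral_const_mul, M.integral_density, Matrix.one_apply]
    simp
  rw [← h]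
  exact integral_re (integrable_finsetSum _ fun i _ => integrable_finsetSum _ fun j _ => hi i j)

/-- The density of the χ²-divergence between the outcome distributions of the states with common
eigenbasis `Z` and spectra `a` and `b`. -/
noncomputable def chiSqDensity {Ω : Type*} [MeasurableSpace Ω] {d : ℕ} (M : POVM Ω (Fin d)) (a b : Fin d → ℝ)
    (Z : Matrix (Fin d) (Fin d) ℂ) (y : Ω) : ℝ :=
  (M.outcome (spectralState a Z) y - M.outcome (spectralState b Z) y) ^ 2
    / M.outcome (spectralState b Z) y

theorem measurable_chiSqDensity {X Ω : Type*} [MeasurableSpace X] [MeasurableSpace Ω]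
    {d : ℕ} (M : POVM Ω (Fin d)) (a b : Fin d → ℝ) {Z : X → Matrix (Fin d) (Fin d) ℂ}
    (hZ : ∀ i j, Measurable fun x => Z x i j) :
    Measurable fun z : X × Ω => ENNReal.ofReal (chiSqDensity M a b (Z z.1) z.2) := by
  have m1 : ∀ c, Measurable fun z : X × Ω => M.outcome (spectralState c (Z z.1)) z.2 := fun c =>
    measurable_outcome_spectralState M c (Z := fun z : X × Ω => Z z.1)
      (fun i j => (hZ i j).comp measurable_fst) measurable_snd
  exact ((((m1 a).sub (m1 b)).pow_const 2).div (m1 b)).ennreal_ofReal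

theorem measurable_lintegral_chiSqDensity {X Ω : Type*} [MeasurableSpace X] [MeasurableSpace Ω]
    {d : ℕ} (M : POVM Ω (Fin d)) (a b : Fin d → ℝ) {Z : X → Matrix (Fin d) (Fin d) ℂ}
    (hZ : ∀ i j, Measurable fun x => Z x i j) :
    Measurable fun x => ∫⁻ y, ENNReal.ofReal (chiSqDensity M a b (Z x) y) ∂M.ref :=
  (measurable_chiSqDensity M a b hZ).lintegral_prod_right'

theorem trace_spectralState {d : ℕ} (a : Fin d → ℝ) (Z : Matrix.unitaryGroup (Fin d) ℂ) :
    (spectralState a Z).trace.re = ∑ i, a i := by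
  have h : (Z : Matrix (Fin d) (Fin d) ℂ)ᴴ * Z = 1 := Matrix.mem_unitaryGroup_iff'.mp Z.2
  rw [spectralState, Matrix.trace_mul_comm, ← Matrix.mul_assoc, h, Matrix.one_mul,
    Matrix.trace_diagonal, ← Complex.ofReal_sum, Complex.ofReal_re]

namespace DominatedSpectra

variable {d : ℕ} {a b : Fin d → ℝ} {C : ℝ}

theorem dominatedDensities (h : DominatedSpectra a b C) (ha : ∑ i, a i = 1) (hb : ∑ i, b i = 1)
    {Ω : Type*} [MeasurableSpace Ω] (M : POVM Ω (Fin d)) (Z : Matrix.unitaryGroup (Fin d) ℂ) :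
    DominatedDensities M.ref (M.outcome (spectralState a Z)) (M.outcome (spectralState b Z)) C where
  measurable_left := measurable_outcome_spectralState M a (Z := fun _ => Z)
    (fun _ _ => measurable_const) measurable_id
  measurable_right := measurable_outcome_spectralState M b (Z := fun _ => Z)
    (fun _ _ => measurable_const) measurable_id
  nonneg_left x := by
    obtain ⟨B, hB⟩ := exists_conjTranspose_mul_self (M.posSemidef_density x)
    rw [POVM.outcome, hB, trace_spectralState_mul_re]
    exact Finset.sum_nonneg fun l _ => Finset.sum_nonneg fun i _ =>
      mul_nonneg (h.nonneg_left i) (sq_nonneg _)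
  nonneg_right x := by
    obtain ⟨B, hB⟩ := exists_conjTranspose_mul_self (M.posSemidef_density x)
    rw [POVM.outcome, hB, trace_spectralState_mul_re]
    exact Finset.sum_nonneg fun l _ => Finset.sum_nonneg fun i _ =>
      mul_nonneg (h.nonneg_right i) (sq_nonneg _)
  le_mul x := by
    obtain ⟨B, hB⟩ := exists_conjTranspose_mul_self (M.posSemidef_density x)
    rw [POVM.outcome, POVM.outcome, hB, trace_spectralState_mul_re, trace_spectralState_mul_re,
      Finset.mul_sum]
    refine Finset.sum_le_sum fun l _ => ?_
    rw [Finset.mul_sum]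
    refine Finset.sum_le_sum fun i _ => ?_
    rw [← mul_assoc]
    exact mul_le_mul_of_nonneg_right (h.le_mul i) (sq_nonneg _)
  one_le := h.one_le
  integrable_left := M.integrable_outcome _
  integrable_right := M.integrable_outcome _
  integral_left := by rw [M.integral_outcome, trace_spectralState, ha]
  integral_right := by rw [M.integral_outcome, trace_spectralState, hb]

/-- The Holevo information of product measurements is at most the sum over the copies of the mean
χ²-divergences with respect to a reference state that the unitaries `V θ` leave invariant. -/
theorem holevoInformation_le (h : DominatedSpectra a b C) (ha : ∑ i, a i = 1) (hb : ∑ i, b i = 1)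
    {n : ℕ} {Ω : Fin n → Type*} [∀ l, MeasurableSpace (Ω l)] (M : ∀ l, POVM (Ω l) (Fin d))
    {Θ : Type*} [MeasurableSpace Θ] (π : Measure Θ) [IsProbabilityMeasure π]
    {Z : Θ → Matrix.unitaryGroup (Fin d) ℂ}
    (hZ : ∀ i j, Measurable fun θ => (Z θ : Matrix (Fin d) (Fin d) ℂ) i j)
    {W : Matrix.unitaryGroup (Fin d) ℂ} (hZb : ∀ θ, spectralState b (Z θ) = spectralState b W) :
    holevoInformation π (fun θ => tensorPow n (spectralState a (Z θ))) (POVM.tensor M)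
      ≤ ∫⁻ θ, ∑ l, ∫⁻ y, ENNReal.ofReal (chiSqDensity (M l) a b (Z θ) y) ∂(M l).ref ∂π := by
  have hD := fun θ l => h.dominatedDensities ha hb (M l) (Z θ)
  have hDW := fun l => h.dominatedDensities ha hb (M l) W
  set P : Θ → (∀ l, Ω l) → ℝ := fun θ x => ∏ l, (M l).outcome (spectralState a (Z θ)) (x l)
    with hP
  set Q : (∀ l, Ω l) → ℝ := fun x => ∏ l, (M l).outcome (spectralState b W) (x l) with hQ
  have hPm : Measurable fun z : (∀ l, Ω l) × Θ => P z.2 z.1 :=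
    Finset.measurable_prod _ fun l _ => measurable_outcome_spectralState (M l) a
      (Z := fun z : (∀ l, Ω l) × Θ => Z z.2) (fun i j => (hZ i j).comp measurable_snd) ((measurable_pi_apply l).comp measurable_fst)
  have hQm : Measurable Q :=
    Finset.measurable_prod _ fun l _ => measurable_outcome_spectralState (M l) b
      (Z := fun _ => W) (fun i j => measurable_const) (measurable_pi_apply l)
  have hPQ : ∀ θ x, P θ x ≤ C ^ n * Q x := by
    intro θ x
    have e : C ^ n * Q x = ∏ l : Fin n, C * (M l).outcome (spectralState b W) (x l) := by
      rw [Finset.prod_mul_distrib]; simp [hQ]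
    rw [e]
    refine Finset.prod_le_prod (fun l _ => (hD θ l).nonneg_left _) fun l _ => ?_
    rw [← hZb θ]
    exact (hD θ l).le_mul _
  calc _ ≤ ∫⁻ x, ∫⁻ θ, ENNReal.ofReal (relEntropyDensity (P θ x) (Q x)) ∂π
          ∂(POVM.tensor M).ref := by
        refine lintegral_mono fun x => ?_
        simp only [outcome_tensorPow_spectralState]
        exact ofReal_negMulLog_sub_le π (hPm.comp measurable_prodMk_left)
          (fun θ => Finset.prod_nonneg fun l _ => (hD θ l).nonneg_left _)
          (Finset.prod_nonneg fun l _ => (hDW l).nonneg_right _) fun θ => hPQ θ x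
    _ = ∫⁻ θ, ∫⁻ x, ENNReal.ofReal (relEntropyDensity (P θ x) (Q x))
          ∂(POVM.tensor M).ref ∂π := by
        refine lintegral_lintegral_swap (Measurable.aemeasurable ?_)
        have hQm' : Measurable fun z : (∀ l, Ω l) × Θ => Q z.1 := hQm.comp measurable_fst
        exact (((hPm.mul (hPm.div hQm').log).sub hPm).add hQm').ennreal_ofReal
    _ ≤ _ := by
        refine lintegral_mono fun θ => ?_
        have := DominatedDensities.lintegral_relEntropyDensity_pi_le (hD θ)
        simp only [hP, hQ, ← hZb θ]
        exact this

/-- The mean χ²-divergence over a Haar random `W`: the traces of the POVM elements integrate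
to `d`. -/
theorem lintegral_chiSqDensity_le (h : DominatedSpectra a b C) {κ : ℝ} (hκ0 : 0 ≤ κ)
    (hκ : ∀ ν : Measure (Fin d → ℂ), IsSphereLaw ν → ∫ w, diagChiSq a b w ∂ν ≤ κ)
    {Ω : Type*} [MeasurableSpace Ω] (M : POVM Ω (Fin d)) (V : Matrix.unitaryGroup (Fin d) ℂ) :
    ∫⁻ W, ∫⁻ y, ENNReal.ofReal (chiSqDensity M a b
      (W * V : Matrix.unitaryGroup (Fin d) ℂ) y) ∂M.ref ∂unitaryHaar d
      ≤ ENNReal.ofReal (κ * d) := by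
  have hm : ∀ i j, Measurable fun W : Matrix.unitaryGroup (Fin d) ℂ =>
      ((W * V : Matrix.unitaryGroup (Fin d) ℂ) : Matrix (Fin d) (Fin d) ℂ) i j := fun i j =>
    ((continuous_unitaryGroup_apply i j).comp (continuous_mul_const V)).measurable
  have htr : ∀ y, 0 ≤ M.outcome 1 y := fun y => by
    obtain ⟨B, hB⟩ := exists_conjTranspose_mul_self (M.posSemidef_density y)
    rw [POVM.outcome, Matrix.one_mul, hB, trace_conjTranspose_mul_self_re]
    positivity
  rw [lintegral_lintegral_swap (f := fun (W : Matrix.unitaryGroup (Fin d) ℂ) y =>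
    ENNReal.ofReal (chiSqDensity M a b (W * V : Matrix.unitaryGroup (Fin d) ℂ) y))
    (measurable_chiSqDensity M a b (Z := fun W : Matrix.unitaryGroup (Fin d) ℂ =>
      (W * V : Matrix.unitaryGroup (Fin d) ℂ)) hm).aemeasurable]
  calc _ ≤ ∫⁻ y, ENNReal.ofReal (κ * M.outcome 1 y) ∂M.ref := by
        refine lintegral_mono fun y => ?_
        have := h.lintegral_chiSq_le hκ V (M.posSemidef_density y)
        rw [POVM.outcome, Matrix.one_mul]
        exact this
    _ = ENNReal.ofReal (∫ y, κ * M.outcome 1 y ∂M.ref) :=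
        (ofReal_integral_eq_lintegral_ofReal ((M.integrable_outcome 1).const_mul κ)
          (Filter.Eventually.of_forall fun y => mul_nonneg hκ0 (htr y))).symm
    _ = _ := by
        rw [integral_const_mul, M.integral_outcome, Matrix.trace_one]
        simp

/-- Averaging over a Haar random `W`: if `κ` bounds the mean of `diagChiSq a b` on the unit sphere,
then some `W` makes the Holevo information of the rotated ensemble at most `n κ d`. -/
theorem exists_holevoInformation_le (h : DominatedSpectra a b C) (ha : ∑ i, a i = 1)
    (hb : ∑ i, b i = 1) {κ : ℝ} (hκ0 : 0 ≤ κ)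
    (hκ : ∀ ν : Measure (Fin d → ℂ), IsSphereLaw ν → ∫ w, diagChiSq a b w ∂ν ≤ κ)
    {n : ℕ} {Ω : Fin n → Type*} [∀ l, MeasurableSpace (Ω l)] (M : ∀ l, POVM (Ω l) (Fin d))
    {Θ : Type*} [MeasurableSpace Θ] (π : Measure Θ) [IsProbabilityMeasure π]
    {V : Θ → Matrix.unitaryGroup (Fin d) ℂ}
    (hV : ∀ i j, Measurable fun θ => (V θ : Matrix (Fin d) (Fin d) ℂ) i j)
    (hVb : ∀ θ, spectralState b (V θ) = spectralState b 1) :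
    ∃ W : Matrix.unitaryGroup (Fin d) ℂ,
      holevoInformation π (fun θ => tensorPow n
        (spectralState a (W * V θ : Matrix.unitaryGroup (Fin d) ℂ))) (POVM.tensor M)
        ≤ ENNReal.ofReal (n * (κ * d)) := by
  have hWV : ∀ i j, Measurable fun z : Matrix.unitaryGroup (Fin d) ℂ × Θ =>
      ((z.1 * V z.2 : Matrix.unitaryGroup (Fin d) ℂ) : Matrix (Fin d) (Fin d) ℂ) i j := by
    intro i j
    simp only [Submonoid.coe_mul, Matrix.mul_apply]
    exact Finset.measurable_sum _ fun k _ =>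
      ((continuous_unitaryGroup_apply i k).measurable.comp measurable_fst).mul
        ((hV k j).comp measurable_snd)
  have hWθ : ∀ θ i j, Measurable fun W : Matrix.unitaryGroup (Fin d) ℂ =>
      ((W * V θ : Matrix.unitaryGroup (Fin d) ℂ) : Matrix (Fin d) (Fin d) ℂ) i j := fun θ i j =>
    ((continuous_unitaryGroup_apply i j).comp (continuous_mul_const (V θ))).measurable
  set F : Matrix.unitaryGroup (Fin d) ℂ × Θ → ℝ≥0∞ := fun z =>
    ∑ l, ∫⁻ y, ENNReal.ofReal (chiSqDensity (M l) a b
      (z.1 * V z.2 : Matrix.unitaryGroup (Fin d) ℂ) y) ∂(M l).ref with hF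
  have hFl : ∀ l, Measurable fun z : Matrix.unitaryGroup (Fin d) ℂ × Θ =>
      ∫⁻ y, ENNReal.ofReal (chiSqDensity (M l) a b
        (z.1 * V z.2 : Matrix.unitaryGroup (Fin d) ℂ) y) ∂(M l).ref := fun l =>
    measurable_lintegral_chiSqDensity (M l) a b (Z := fun z : Matrix.unitaryGroup (Fin d) ℂ × Θ =>
      (z.1 * V z.2 : Matrix.unitaryGroup (Fin d) ℂ)) hWV
  have hFm : Measurable F := Finset.measurable_sum _ fun l _ => hFl l
  have havg : ∫⁻ W, ∫⁻ θ, F (W, θ) ∂π ∂unitaryHaar d ≤ ENNReal.ofReal (n * (κ * d)) := by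
    rw [lintegral_lintegral_swap (f := fun W θ => F (W, θ)) hFm.aemeasurable]
    calc ∫⁻ θ, ∫⁻ W, F (W, θ) ∂unitaryHaar d ∂π
        ≤ ∫⁻ _ : Θ, ENNReal.ofReal (n * (κ * d)) ∂π := by
          refine lintegral_mono fun θ => ?_
          have hl : ∀ l, Measurable fun W : Matrix.unitaryGroup (Fin d) ℂ =>
              ∫⁻ y, ENNReal.ofReal (chiSqDensity (M l) a b
                (W * V θ : Matrix.unitaryGroup (Fin d) ℂ) y) ∂(M l).ref := fun l =>
            measurable_lintegral_chiSqDensity (M l) a b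
              (Z := fun W => (W * V θ : Matrix.unitaryGroup (Fin d) ℂ)) (hWθ θ)
          simp only [hF]
          rw [lintegral_finsetSum _ fun l _ => hl l]
          refine (Finset.sum_le_sum fun l _ =>
            h.lintegral_chiSqDensity_le hκ0 hκ (M l) (V θ)).trans_eq ?_
          rw [Finset.sum_const, Finset.card_univ, Fintype.card_fin, nsmul_eq_mul,
            ENNReal.ofReal_mul (Nat.cast_nonneg n), ENNReal.ofReal_natCast]
      _ = _ := by simp
  obtain ⟨W, hW⟩ := exists_le_lintegral (μ := unitaryHaar d)
    (f := fun W => ∫⁻ θ, F (W, θ) ∂π) hFm.lintegral_prod_right'.aemeasurable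
  refine ⟨W, le_trans ?_ (hW.trans havg)⟩
  have hb' : ∀ θ, spectralState b (W * V θ : Matrix.unitaryGroup (Fin d) ℂ)
      = spectralState b W := by
    intro θ
    have e : ∀ X : Matrix (Fin d) (Fin d) ℂ, spectralState b ((W : Matrix (Fin d) (Fin d) ℂ) * X)
        = W * spectralState b X * (W : Matrix (Fin d) (Fin d) ℂ)ᴴ := fun X => by
      simp only [spectralState, Matrix.conjTranspose_mul, Matrix.mul_assoc]
    rw [Submonoid.coe_mul, e, hVb, ← e, Matrix.mul_one]
  exact h.holevoInformation_le ha hb M π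
    (Z := fun θ => W * V θ) (fun i j => (hWV i j).comp (measurable_prodMk_left (x := W))) hb'

end DominatedSpectra

/-! ### The two ensembles in spectral form -/

/-- The spectrum of `τ_{t,U}` is dominated by that of the maximally mixed state. -/
theorem dominatedSpectra_tau {d : ℕ} {t : ℝ} (ht0 : 0 ≤ t) (ht1 : t ≤ 1) :
    DominatedSpectra (tauSpectrum d t) (fun _ => 1 / d) 2 where
  nonneg_left i := by
    unfold tauSpectrum
    split_ifs
    · positivity
    · exact div_nonneg (by linarith) (Nat.cast_nonneg d)
  nonneg_right i := by positivity
  one_le := one_le_two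
  le_mul i := by
    rw [mul_one_div]
    unfold tauSpectrum
    split_ifs <;> exact div_le_div_of_nonneg_right (by linarith) (Nat.cast_nonneg d)

theorem cast_half_of_even {d : ℕ} (he : Even d) : ((d / 2 : ℕ) : ℝ) = d / 2 := by
  rw [Nat.cast_div he.two_dvd (by norm_num)]; norm_num

theorem sum_tauSpectrum {d : ℕ} (hd : 0 < d) (he : Even d) (t : ℝ) :
    ∑ i, tauSpectrum d t i = 1 := by
  have hd0 : (d : ℝ) ≠ 0 := by exact_mod_cast hd.ne'
  simp only [tauSpectrum]
  rw [sum_fin_ite_lt (Nat.div_le_self d 2), cast_half_of_even he]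
  field_simp
  ring

theorem spectralState_const {d : ℕ} (c : ℝ) (Z : Matrix.unitaryGroup (Fin d) ℂ) :
    spectralState (fun _ => c) Z = (c : ℂ) • (1 : Matrix (Fin d) (Fin d) ℂ) := by
  have h : (Z : Matrix (Fin d) (Fin d) ℂ) * (Z : Matrix (Fin d) (Fin d) ℂ)ᴴ = 1 :=
    Matrix.mem_unitaryGroup_iff.mp Z.2
  have hdiag : Matrix.diagonal (fun _ : Fin d => (c : ℂ)) = (c : ℂ) • 1 := by
    rw [Matrix.smul_one_eq_diagonal]
  rw [spectralState, hdiag, Matrix.mul_smul, Matrix.mul_one, Matrix.smul_mul, h]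

theorem tauState_eq_spectralState {d : ℕ} (he : Even d) (t : ℝ)
    (Z : Matrix.unitaryGroup (Fin d) ℂ) :
    tauState d (d / 2) t Z = spectralState (tauSpectrum d t) Z := by
  have h : (Z : Matrix (Fin d) (Fin d) ℂ) * (Z : Matrix (Fin d) (Fin d) ℂ)ᴴ = 1 :=
    Matrix.mem_unitaryGroup_iff.mp Z.2
  have e1 : (1 + t) / (2 * ((d / 2 : ℕ) : ℝ)) = (1 + t) / d := by
    rw [cast_half_of_even he]; congr 1; ring
  have e2 : (1 - t) / (2 * ((d : ℝ) - ((d / 2 : ℕ) : ℝ))) = (1 - t) / d := by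
    rw [cast_half_of_even he]; congr 1; ring
  have hdiag : Matrix.diagonal (fun i => (tauSpectrum d t i : ℂ))
      = (((1 + t) / d : ℝ) : ℂ) • projQ d (d / 2)
        + (((1 - t) / d : ℝ) : ℂ) • (1 - projQ d (d / 2)) := by
    ext i j
    by_cases hij : i = j
    · subst hij
      by_cases hi : (i : ℕ) < d / 2 <;> simp [projQ, tauSpectrum, hi]
    · simp [projQ, hij]
  rw [tauState, e1, e2, spectralState, hdiag, Matrix.mul_add, Matrix.add_mul, Matrix.mul_smul,
    Matrix.mul_smul, Matrix.smul_mul, Matrix.smul_mul, Matrix.mul_sub, Matrix.sub_mul,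
    Matrix.mul_one, h]

theorem dominatedSpectra_omega {k r : ℕ} {t : ℝ} (hr : 1 ≤ r) (hrk : r ≤ k) (ht : 0 < t)
    (ht1 : t < 1 / 3) : DominatedSpectra (omegaSpectrum k r t) (omegaMeanSpectrum k t) k where
  nonneg_left i := by
    unfold omegaSpectrum
    split_ifs
    · linarith
    · positivity
    · exact le_rfl
  nonneg_right i := by
    unfold omegaMeanSpectrum
    split_ifs
    · linarith
    · positivity
  one_le := by exact_mod_cast hr.trans hrk
  le_mul i := by
    have hr1 : (1 : ℝ) ≤ r := by exact_mod_cast hr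
    have hk1 : (1 : ℝ) ≤ k := by exact_mod_cast hr.trans hrk
    have hkt : (k : ℝ) * (t / k) = t := by field_simp
    unfold omegaSpectrum omegaMeanSpectrum
    split_ifs
    · nlinarith
    · rw [hkt]; exact div_le_self ht.le hr1
    · rw [hkt]; exact ht.le

theorem sum_omegaSpectrum {k r : ℕ} (hr : 1 ≤ r) (hrk : r ≤ k) (t : ℝ) :
    ∑ i, omegaSpectrum k r t i = 1 := by
  have hr0 : (r : ℝ) ≠ 0 := by exact_mod_cast (by omega : r ≠ 0)
  rw [Fin.sum_univ_succ]
  simp only [omegaSpectrum, Fin.val_zero, if_true, Fin.val_succ, Nat.succ_ne_zero, if_false,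
    Nat.succ_le_iff]
  rw [sum_fin_ite_lt hrk]
  field_simp
  ring

theorem sum_omegaMeanSpectrum {k : ℕ} (hk : 1 ≤ k) (t : ℝ) :
    ∑ i, omegaMeanSpectrum k t i = 1 := by
  have hk0 : (k : ℝ) ≠ 0 := by exact_mod_cast (by omega : k ≠ 0)
  rw [Fin.sum_univ_succ]
  simp [omegaMeanSpectrum]
  field_simp
  ring

theorem embedMatrix_conjTranspose {k : ℕ} (U : Matrix (Fin k) (Fin k) ℂ) :
    (embedMatrix U)ᴴ = embedMatrix Uᴴ := by
  ext i j
  refine Fin.cases ?_ (fun i => ?_) i <;> refine Fin.cases ?_ (fun j => ?_) j <;>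
    simp [embedMatrix]

theorem embedMatrix_mem_unitaryGroup {k : ℕ} (U : Matrix.unitaryGroup (Fin k) ℂ) :
    embedMatrix (U : Matrix (Fin k) (Fin k) ℂ) ∈ Matrix.unitaryGroup (Fin (k + 1)) ℂ := by
  have h : (U : Matrix (Fin k) (Fin k) ℂ) * (U : Matrix (Fin k) (Fin k) ℂ)ᴴ = 1 :=
    Matrix.mem_unitaryGroup_iff.mp U.2
  rw [Matrix.mem_unitaryGroup_iff, Matrix.star_eq_conjTranspose, embedMatrix_conjTranspose]
  ext i j
  refine Fin.cases ?_ (fun i => ?_) i <;> refine Fin.cases ?_ (fun j => ?_) j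
  · simp [Matrix.mul_apply, Fin.sum_univ_succ, embedMatrix]
  · simp [Matrix.mul_apply, Fin.sum_univ_succ, embedMatrix, (Fin.succ_ne_zero j).symm]
  · simp [Matrix.mul_apply, Fin.sum_univ_succ, embedMatrix]
  · have := congrFun (congrFun h i) j
    rw [Matrix.mul_apply] at this
    rw [Matrix.mul_apply, Fin.sum_univ_succ]
    simpa [embedMatrix, Matrix.one_apply] using this

/-- The average of `ω_{t,U}` over all `U` is invariant under `1 ⊕ U`. -/
theorem spectralState_omegaMean_embed {k : ℕ} (t : ℝ) (U : Matrix.unitaryGroup (Fin k) ℂ) :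
    spectralState (omegaMeanSpectrum k t) (embedMatrix (U : Matrix (Fin k) (Fin k) ℂ))
      = spectralState (omegaMeanSpectrum k t) 1 := by
  have hcomm : embedMatrix (U : Matrix (Fin k) (Fin k) ℂ)
      * Matrix.diagonal (fun i => (omegaMeanSpectrum k t i : ℂ))
      = Matrix.diagonal (fun i => (omegaMeanSpectrum k t i : ℂ))
        * embedMatrix (U : Matrix (Fin k) (Fin k) ℂ) := by
    ext i j
    rw [Matrix.mul_diagonal, Matrix.diagonal_mul]
    refine Fin.cases ?_ (fun i => ?_) i <;> refine Fin.cases ?_ (fun j => ?_) j <;>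
      simp [embedMatrix, omegaMeanSpectrum, mul_comm]
  have h : embedMatrix (U : Matrix (Fin k) (Fin k) ℂ)
      * (embedMatrix (U : Matrix (Fin k) (Fin k) ℂ))ᴴ = 1 :=
    Matrix.mem_unitaryGroup_iff.mp (embedMatrix_mem_unitaryGroup U)
  rw [spectralState, hcomm, Matrix.mul_assoc, h, spectralState]
  simp

theorem conj_omegaState_eq_spectralState {k : ℕ} (r : ℕ) (t : ℝ)
    (W : Matrix (Fin (k + 1)) (Fin (k + 1)) ℂ) (U : Matrix (Fin k) (Fin k) ℂ) :
    W * omegaState k r t U * Wᴴ = spectralState (omegaSpectrum k r t) (W * embedMatrix U) := by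
  have hdiag : omegaBase k r t = Matrix.diagonal (fun i => (omegaSpectrum k r t i : ℂ)) := by
    rw [omegaBase]
    congr 1
    funext i
    unfold omegaSpectrum
    split_ifs <;> simp
  rw [omegaState, spectralState, hdiag, Matrix.conjTranspose_mul]
  simp only [Matrix.mul_assoc]

theorem mainTheorem7 :
    -- the ensemble `τ_{t,U}`, with `d` even and `r = d/2`
    (∀ (d n : ℕ) (t : ℝ), 0 < d → Even d → 0 ≤ t → t ≤ 1 →
      ∀ (Ω : Fin n → Type*) [∀ a, MeasurableSpace (Ω a)] (M : ∀ a, POVM (Ω a) (Fin d))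
        (Θ : Type*) [MeasurableSpace Θ] (π : Measure Θ) [IsProbabilityMeasure π]
        (U : Θ → Matrix.unitaryGroup (Fin d) ℂ),
        (∀ i j, Measurable fun θ => (U θ : Matrix (Fin d) (Fin d) ℂ) i j) →
        ∃ W : Matrix.unitaryGroup (Fin d) ℂ,
          holevoInformation π
              (fun θ => tensorPow n
                (tauState d (d / 2) t ((W * U θ : Matrix.unitaryGroup (Fin d) ℂ) :
                  Matrix (Fin d) (Fin d) ℂ)))
              (POVM.tensor M)
            ≤ ENNReal.ofReal (n * t ^ 2 / d)) ∧
    -- the ensemble `ω_{t,U}` in dimension `d = k + 1`, with `U` in `𝕌(d - 1)`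
    (∀ (k n r : ℕ) (t : ℝ), 3 ≤ k + 1 → 1 ≤ r → r + 1 ≤ k + 1 → 0 < t → t < 1 / 3 →
      ∀ (Ω : Fin n → Type*) [∀ a, MeasurableSpace (Ω a)] (M : ∀ a, POVM (Ω a) (Fin (k + 1)))
        (Θ : Type*) [MeasurableSpace Θ] (π : Measure Θ) [IsProbabilityMeasure π]
        (U : Θ → Matrix.unitaryGroup (Fin k) ℂ),
        (∀ i j, Measurable fun θ => (U θ : Matrix (Fin k) (Fin k) ℂ) i j) →
        ∃ W : Matrix.unitaryGroup (Fin (k + 1)) ℂ,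
          holevoInformation π
              (fun θ => tensorPow n
                ((W : Matrix (Fin (k + 1)) (Fin (k + 1)) ℂ) *
                  omegaState k r t (U θ : Matrix (Fin k) (Fin k) ℂ) *
                  (W : Matrix (Fin (k + 1)) (Fin (k + 1)) ℂ)ᴴ))
              (POVM.tensor M)
            ≤ ENNReal.ofReal (4 * (n * t ^ 2 / r) * Real.log (2 / t))) := by
  refine ⟨?_, ?_⟩
  · intro d n t hd he ht0 ht1 Ω _ M Θ _ π _ U hU
    have hd0 : (d : ℝ) ≠ 0 := by exact_mod_cast hd.ne'
    obtain ⟨W, hW⟩ := (dominatedSpectra_tau (d := d) ht0 ht1).exists_holevoInformation_le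
      (sum_tauSpectrum hd he t) (by simp [hd0]) (by positivity)
      (fun ν hν => hν.integral_diagChiSq_tau_le hd he t) M π hU
      (fun θ => (spectralState_const _ (U θ)).trans (spectralState_const _ 1).symm)
    refine ⟨W, ?_⟩
    simp only [tauState_eq_spectralState he]
    refine hW.trans_eq ?_
    congr 1
    field_simp
  · intro k n r t _ hr hrk ht ht3 Ω _ M Θ _ π _ U hU
    have hrk' : r ≤ k := Nat.le_of_succ_le_succ hrk
    have hr0 : (r : ℝ) ≠ 0 := by exact_mod_cast (by omega : r ≠ 0)
    have hk0 : (k : ℝ) + 1 ≠ 0 := by positivity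
    have hlog : 0 ≤ Real.log (2 / t) :=
      Real.log_nonneg (by rw [le_div_iff₀ ht]; linarith)
    have hV : ∀ i j, Measurable fun θ => embedMatrix (U θ : Matrix (Fin k) (Fin k) ℂ) i j := by
      intro i j
      refine Fin.cases ?_ (fun i => ?_) i <;> refine Fin.cases ?_ (fun j => ?_) j
      · exact measurable_const
      · exact measurable_const
      · exact measurable_const
      · exact hU i j
    obtain ⟨W, hW⟩ := (dominatedSpectra_omega hr hrk' ht ht3).exists_holevoInformation_le
      (sum_omegaSpectrum hr hrk' t) (sum_omegaMeanSpectrum (hr.trans hrk') t) (by positivity)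
      (fun ν hν => hν.integral_diagChiSq_omega_le hr hrk' ht ht3) M π
      (V := fun θ => ⟨embedMatrix (U θ : Matrix (Fin k) (Fin k) ℂ),
        embedMatrix_mem_unitaryGroup (U θ)⟩) hV
      (fun θ => spectralState_omegaMean_embed t (U θ))
    refine ⟨W, ?_⟩
    simp only [conj_omegaState_eq_spectralState]
    refine hW.trans_eq ?_
    congr 1
    push_cast
    field_simp
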